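/- Let $\mathbb K$ be a field of characteristic $0$, let $G$ be a finite abelian group, and let $V$ be a $\mathbb K$-vector space with basis $v_1,\dots,v_n$ on which $G$ acts diagonally, ${}^gv_i=\chi_i(g)v_i$ with characters $\chi_i:G\to\mathbb K^*$. Let ${\bf q}=\{q_{ij}\}\subset\mathbb K^*$ satisfy $q_{ii}=1$ and $q_{ji}=q_{ij}^{-1}$, and let $\kappa:V\times V\to V\otimes\mathbb KG$ be bilinear with $\kappa(v_i,v_j)=-q_{ij}\,\kappa(v_j,v_i)$. Put $$\mathcal H_{{\bf q},\kappa}=(T(V)\rtimes G)/\big(v_iv_j-q_{ij}v_jv_i-\kappa(v_i,v_j):1\le i,j\le n\big).$$ Assume that $\mathcal H_{{\bf q},\kappa}$ is a quantum Drinfeld orbifold algebra, i.e. the monomials $v_1^{m_1}\cdots v_n^{m_n}g$ ($m_i\in\mathbb N$, $g\in G$) form a $\mathbb K$-basis of it, and that the strong vanishing condition holds: for all $g\in G$ and all $1\le i,j,k,r\le n$, if the coefficient of $v_r\otimes g$ in $\kappa(v_i,v_j)$ is nonzero, then ${}^gv_k=q_{ik}q_{jk}q_{kr}\,v_k$. Let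 $A=\mathbb Z^n\times G$, let $|v_i|=(a_i,1_G)$ with $a_1,\dots,a_n$ the standard basis of $\mathbb Z^n$, let $|g|=(0,g)$ and $|v_i\otimes g|=|v_i||g|$, and let $N\le A$ be the subgroup generated by all $|v_i||v_j||v_r|^{-1}|g|^{-1}$ for which the coefficient of $v_r\otimes g$ in $\kappa(v_i,v_j)$ is nonzero. Then there is an antisymmetric bicharacter $\epsilon:A/N\times A/N\to\mathbb K^*$ with $\epsilon(|g|,|h|)=1$ and $$\epsilon(|v_i\otimes g|,|v_j\otimes h|)=q_{ij}\,\chi_j(g)\,\chi_i^{-1}(h)\qquad(g,h\in G,\ 1\le i,j\le n)$$ such that the following holds. Let $\mathcal C$ be the monoidal category of those $A/N$-graded $\mathbb KG$-bimodules $M$ (with $g\in G$ placed in degree $|g|$) that satisfy $g\,m=\epsilon(|g|,|m|)\,m\,g$ for all $g\in G$ and all homogeneous $m\in M$, with graded bimodule morphisms and monoidal product $\otimes_{\mathbb KG}$. It is symmetric monoidal with the braiding $\tau(m\otimes n)=\epsilon(|m|,|n|)\,n\otimes m$ for homogeneous $m,n$. Then $\mathcal H_{{\bf q},\kappa}$,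 with $G$ acting by left and right multiplication and graded by $A/N$ so that the word $v_{i_1}\cdots v_{i_m}g$ has degree $|v_{i_1}|\cdots|v_{i_m}||g|$, is an object of $\mathcal C$, and it is a Hopf algebra in $\mathcal C$ (a braided Hopf algebra). Its multiplication is that of $\mathcal H_{{\bf q},\kappa}$, its unit is $\mathbb KG\to\mathcal H_{{\bf q},\kappa}$, and its comultiplication $\Delta$, counit $\eta$ and antipode $S$ satisfy $$\Delta(v_i)=v_i\otimes 1+1\otimes v_i,\qquad \eta(v_i)=0,\qquad S(v_i)=-v_i\qquad(1\le i\le n).$$ -/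

import Mathlib

open CategoryTheory MonoidalCategory TensorProduct

universe u w

noncomputable section

/-- A bimodule over the group algebra `k[G]`, graded by the abelian group `B`, where `G` itself is
graded by `B` through `d : G →* B`.  The bimodule structure is given by the commuting `k`-linear
left and right actions of the elements of `G`. -/
structure GradedBimod (k : Type u) [Field k] {G : Type u} [Group G] {B : Type w} [CommGroup B]
    (d : G →* B) where
  carrier : Type u
  [addCommGroup : AddCommGroup carrier]
  [module : Module k carrier]
  /-- the left action `m ↦ g m` -/
  lact : G → carrier →ₗ[k] carrier
  /-- the right action `m ↦ m g` -/
  ract : G → carrier →ₗ[k] carrier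
  lact_one : ∀ m, lact 1 m = m
  lact_mul : ∀ g h m, lact (g * h) m = lact g (lact h m)
  ract_one : ∀ m, ract 1 m = m
  ract_mul : ∀ g h m, ract (g * h) m = ract h (ract g m)
  lact_ract : ∀ g h m, lact g (ract h m) = ract h (lact g m)
  /-- the homogeneous components -/
  deg : B → Submodule k carrier
  deg_indep : iSupIndep deg
  deg_iSup : iSup deg = ⊤
  lact_mem : ∀ g b m, m ∈ deg b → lact g m ∈ deg (d g * b)
  ract_mem : ∀ g b m, m ∈ deg b → ract g m ∈ deg (b * d g)

attribute [instance] GradedBimod.addCommGroup GradedBimod.module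

namespace GradedBimod

variable {k : Type u} [Field k] {G : Type u} [Group G] {B : Type w} [CommGroup B] {d : G →* B}

/-- Graded bimodule morphisms. -/
@[ext]
structure Hom (M N : GradedBimod k d) where
  toLin : M.carrier →ₗ[k] N.carrier
  map_lact : ∀ g m, toLin (M.lact g m) = N.lact g (toLin m)
  map_ract : ∀ g m, toLin (M.ract g m) = N.ract g (toLin m)
  map_deg : ∀ b m, m ∈ M.deg b → toLin m ∈ N.deg b

instance : Category (GradedBimod k d) where
  Hom := Hom
  id M := ⟨LinearMap.id, fun _ _ => rfl, fun _ _ => rfl, fun _ _ h => h⟩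
  comp f g := ⟨g.toLin ∘ₗ f.toLin, fun a m => by simp [f.map_lact, g.map_lact],
    fun a m => by simp [f.map_ract, g.map_ract], fun b m h => g.map_deg b _ (f.map_deg b m h)⟩

@[ext]
theorem hom_ext {M N : GradedBimod k d} {f g : M ⟶ N} (h : f.toLin = g.toLin) : f = g :=
  Hom.ext h

@[simp]
theorem id_toLin (M : GradedBimod k d) : Hom.toLin (𝟙 M) = LinearMap.id := rfl

@[simp]
theorem comp_toLin {M N P : GradedBimod k d} (f : M ⟶ N) (g : N ⟶ P) :
    (f ≫ g).toLin = g.toLin ∘ₗ f.toLin := rfl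

/-! ### Linear maps given on homogeneous elements -/

theorem hom_induction (M : GradedBimod k d) {p : M.carrier → Prop}
    (h : ∀ b, ∀ m ∈ M.deg b, p m) (h0 : p 0) (hadd : ∀ x y, p x → p y → p (x + y))
    (m : M.carrier) : p m :=
  Submodule.iSup_induction M.deg (motive := p) (by rw [M.deg_iSup]; trivial) h h0 hadd

theorem lin_ext {M : GradedBimod k d} {P : Type*} [AddCommGroup P] [Module k P]
    {f g : M.carrier →ₗ[k] P} (h : ∀ b, ∀ m ∈ M.deg b, f m = g m) : f = g := by
  ext m
  induction m using M.hom_induction with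
  | h b m hm => exact h b m hm
  | h0 => simp
  | hadd x y hx hy => simp [hx, hy]

open scoped Classical in
/-- `M` is the direct sum of its components. -/
def decomp (M : GradedBimod k d) : DirectSum B (fun b => M.deg b) ≃ₗ[k] M.carrier :=
  LinearEquiv.ofBijective (DirectSum.coeLinearMap M.deg) <| by
    have := DirectSum.isInternal_submodule_of_iSupIndep_of_iSup_eq_top M.deg_indep M.deg_iSup
    exact this

open scoped Classical in
/-- The linear map that agrees with `f b` on the component of degree `b`. -/
def gradedLift (M : GradedBimod k d) {P : Type*} [AddCommGroup P] [Module k P]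
    (f : B → M.carrier →ₗ[k] P) : M.carrier →ₗ[k] P :=
  DirectSum.toModule k B P (fun b => f b ∘ₗ (M.deg b).subtype) ∘ₗ M.decomp.symm.toLinearMap

theorem gradedLift_of_mem (M : GradedBimod k d) {P : Type*} [AddCommGroup P] [Module k P]
    (f : B → M.carrier →ₗ[k] P) {b : B} {m : M.carrier} (hm : m ∈ M.deg b) :
    M.gradedLift f m = f b m := by
  classical
  have : M.decomp.symm m = DirectSum.lof k B (fun b => M.deg b) b ⟨m, hm⟩ := by
    rw [LinearEquiv.symm_apply_eq]
    exact (DirectSum.coeLinearMap_lof M.deg b ⟨m, hm⟩).symm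
  rw [gradedLift, LinearMap.comp_apply, LinearEquiv.coe_coe, this, DirectSum.toModule_lof]
  rfl

/-- The bilinear map that agrees with `f a b` in degrees `a` and `b`. -/
def gradedLift₂ (M N : GradedBimod k d) {P : Type*} [AddCommGroup P] [Module k P]
    (f : B → B → M.carrier →ₗ[k] N.carrier →ₗ[k] P) : M.carrier →ₗ[k] N.carrier →ₗ[k] P :=
  M.gradedLift fun a => LinearMap.flip (N.gradedLift fun b => LinearMap.flip (f a b))

theorem gradedLift₂_of_mem {M N : GradedBimod k d} {P : Type*} [AddCommGroup P] [Module k P]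
    (f : B → B → M.carrier →ₗ[k] N.carrier →ₗ[k] P) {a b : B} {m : M.carrier} {n : N.carrier}
    (hm : m ∈ M.deg a) (hn : n ∈ N.deg b) : gradedLift₂ M N f m n = f a b m n := by
  rw [gradedLift₂, gradedLift_of_mem M _ hm, LinearMap.flip_apply, gradedLift_of_mem N _ hn,
    LinearMap.flip_apply]

/-- A balanced identity may be checked on homogeneous elements. -/
theorem balanced_of_deg {M N : GradedBimod k d} {P : Type*} [AddCommGroup P] [Module k P]
    (f : M.carrier →ₗ[k] N.carrier →ₗ[k] P)
    (h : ∀ g a m b n, m ∈ M.deg a → n ∈ N.deg b → f (M.ract g m) n = f m (N.lact g n))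
    (g : G) (m : M.carrier) (n : N.carrier) : f (M.ract g m) n = f m (N.lact g n) := by
  have : f ∘ₗ M.ract g = f.compl₂ (N.lact g) :=
    lin_ext fun a m hm => lin_ext fun b n hn => by simpa using h g a m b n hm hn
  simpa using LinearMap.congr_fun₂ this m n

theorem indep_of_coaction {I M : Type*} [AddCommGroup M] [Module k M] (deg : I → Submodule k M)
    (δ : M →ₗ[k] (I →₀ M)) (h : ∀ b, ∀ m ∈ deg b, δ m = Finsupp.single b m) :
    iSupIndep deg := by
  classical
  apply iSupIndep_of_dfinsupp_lsum_injective
  rw [← LinearMap.ker_eq_bot, LinearMap.ker_eq_bot']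
  intro x hx
  have key : ∀ y : Π₀ b : I, deg b, ∀ c,
      δ (DFinsupp.lsum ℕ (fun b => (deg b).subtype) y) c = y c := by
    intro y c
    induction y using DFinsupp.induction with
    | h0 => simp
    | ha b m f _ _ ih =>
      rw [map_add, map_add, Finsupp.add_apply, ih]
      simp only [DFinsupp.lsum_single, Submodule.coe_subtype, DFinsupp.add_apply,
        Submodule.coe_add, h b m m.2]
      congr 1
      by_cases hbc : b = c
      · subst hbc; simp
      · simp [hbc, DFinsupp.single_apply]
  ext c
  rw [← key x c]
  have hx' : DFinsupp.lsum ℕ (fun b => (deg b).subtype) x = 0 := hx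
  rw [hx']; simp

/-! ### The tensor product over the group algebra -/

/-- The relations `m g ⊗ n = m ⊗ g n`. -/
def balRel (M N : GradedBimod k d) : Submodule k (M.carrier ⊗[k] N.carrier) :=
  Submodule.span k {x | ∃ m g n, x = M.ract g m ⊗ₜ[k] n - m ⊗ₜ[k] N.lact g n}

/-- The tensor product `M ⊗_{k[G]} N`. -/
def Bal (M N : GradedBimod k d) : Type u := (M.carrier ⊗[k] N.carrier) ⧸ balRel M N

instance (M N : GradedBimod k d) : AddCommGroup (Bal M N) :=
  inferInstanceAs (AddCommGroup ((M.carrier ⊗[k] N.carrier) ⧸ balRel M N))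

instance (M N : GradedBimod k d) : Module k (Bal M N) :=
  inferInstanceAs (Module k ((M.carrier ⊗[k] N.carrier) ⧸ balRel M N))

/-- The class of `m ⊗ n` in `M ⊗_{k[G]} N`. -/
def tmk (M N : GradedBimod k d) : M.carrier →ₗ[k] N.carrier →ₗ[k] Bal M N :=
  (TensorProduct.mk k M.carrier N.carrier).compr₂ (balRel M N).mkQ

theorem mk_bal {M N : GradedBimod k d} (g : G) (m : M.carrier) (n : N.carrier) :
    tmk M N (M.ract g m) n = tmk M N m (N.lact g n) := by
  have : (balRel M N).mkQ (M.ract g m ⊗ₜ[k] n) = (balRel M N).mkQ (m ⊗ₜ[k] N.lact g n) := by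
    rw [← sub_eq_zero, ← map_sub, Submodule.mkQ_apply, Submodule.Quotient.mk_eq_zero]
    exact Submodule.subset_span ⟨m, g, n, rfl⟩
  exact this

/-- The universal property of the tensor product over `k[G]`. -/
def balLift {M N : GradedBimod k d} {P : Type*} [AddCommGroup P] [Module k P]
    (f : M.carrier →ₗ[k] N.carrier →ₗ[k] P)
    (hf : ∀ g m n, f (M.ract g m) n = f m (N.lact g n)) : Bal M N →ₗ[k] P :=
  (balRel M N).liftQ (TensorProduct.lift f) (by
    rw [balRel, Submodule.span_le]
    rintro _ ⟨m, g, n, rfl⟩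
    simp [hf])

@[simp]
theorem balLift_mk {M N : GradedBimod k d} {P : Type*} [AddCommGroup P] [Module k P]
    (f : M.carrier →ₗ[k] N.carrier →ₗ[k] P)
    (hf : ∀ g m n, f (M.ract g m) n = f m (N.lact g n)) (m : M.carrier) (n : N.carrier) :
    balLift f hf (tmk M N m n) = f m n := by
  change (balRel M N).liftQ (TensorProduct.lift f) _ ((balRel M N).mkQ (m ⊗ₜ n)) = _
  simp

theorem bal_ext {M N : GradedBimod k d} {P : Type*} [AddCommGroup P] [Module k P]
    {f g : Bal M N →ₗ[k] P} (h : ∀ m n, f (tmk M N m n) = g (tmk M N m n)) : f = g := by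
  apply Submodule.linearMap_qext (p := balRel M N)
  exact TensorProduct.ext' h

theorem bal_ext_deg {M N : GradedBimod k d} {P : Type*} [AddCommGroup P] [Module k P]
    {f g : Bal M N →ₗ[k] P}
    (h : ∀ a, ∀ m ∈ M.deg a, ∀ b, ∀ n ∈ N.deg b, f (tmk M N m n) = g (tmk M N m n)) : f = g := by
  have : (tmk M N).compr₂ f = (tmk M N).compr₂ g :=
    lin_ext fun a m hm => lin_ext fun b n hn => h a m hm b n hn
  exact bal_ext fun m n => LinearMap.congr_fun₂ this m n

theorem bal_induction {M N : GradedBimod k d} {p : Bal M N → Prop}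
    (hmk : ∀ m n, p (tmk M N m n)) (hadd : ∀ x y, p x → p y → p (x + y)) (x : Bal M N) : p x := by
  obtain ⟨x, rfl⟩ := (balRel M N).mkQ_surjective x
  induction x using TensorProduct.induction_on with
  | zero =>
    have h := hmk 0 0
    rw [map_zero] at h
    rw [map_zero]
    exact h
  | tmul m n => exact hmk m n
  | add x y hx hy => rw [map_add]; exact hadd _ _ hx hy

/-- The component of degree `c` of `M ⊗_{k[G]} N` is spanned by the `m ⊗ n` with `|m| |n| = c`. -/
def balDeg (M N : GradedBimod k d) (c : B) : Submodule k (Bal M N) :=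
  Submodule.span k {x | ∃ a b m n, m ∈ M.deg a ∧ n ∈ N.deg b ∧ a * b = c ∧ x = tmk M N m n}

theorem mk_mem {M N : GradedBimod k d} {a b c : B} {m : M.carrier} {n : N.carrier}
    (hm : m ∈ M.deg a) (hn : n ∈ N.deg b) (h : a * b = c) : tmk M N m n ∈ balDeg M N c :=
  Submodule.subset_span ⟨a, b, m, n, hm, hn, h, rfl⟩

/-- A linear map on `M ⊗ N` is compatible with degrees if it is so on homogeneous tensors. -/
theorem balDeg_le {M N : GradedBimod k d} {P : Type*} [AddCommGroup P] [Module k P]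
    (f : Bal M N →ₗ[k] P) (c : B) (S : Submodule k P)
    (h : ∀ a b m n, m ∈ M.deg a → n ∈ N.deg b → a * b = c → f (tmk M N m n) ∈ S) (x : Bal M N)
    (hx : x ∈ balDeg M N c) : f x ∈ S := by
  have : balDeg M N c ≤ S.comap f := by
    rw [balDeg, Submodule.span_le]
    rintro _ ⟨a, b, m, n, hm, hn, hc, rfl⟩
    exact h a b m n hm hn hc
  exact this hx

/-- The degree decomposition of `M ⊗_{k[G]} N`, used to see that the sum of components is direct. -/
def balCoaction (M N : GradedBimod k d) : Bal M N →ₗ[k] (B →₀ Bal M N) :=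
  balLift (gradedLift₂ M N fun a b => (tmk M N).compr₂ (Finsupp.lsingle (a * b)))
    (balanced_of_deg _ fun g a m b n hm hn => by
      rw [gradedLift₂_of_mem _ (M.ract_mem g a m hm) hn,
        gradedLift₂_of_mem _ hm (N.lact_mem g b n hn)]
      simp [mk_bal, mul_assoc])

theorem balCoaction_mk {M N : GradedBimod k d} {a b : B} {m : M.carrier} {n : N.carrier}
    (hm : m ∈ M.deg a) (hn : n ∈ N.deg b) :
    balCoaction M N (tmk M N m n) = Finsupp.single (a * b) (tmk M N m n) := by
  rw [balCoaction, balLift_mk, gradedLift₂_of_mem _ hm hn]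
  simp

/-- The left action `g (m ⊗ n) = g m ⊗ n`. -/
def balLact (M N : GradedBimod k d) (g : G) : Bal M N →ₗ[k] Bal M N :=
  balLift (tmk M N ∘ₗ M.lact g) (fun h m n => by simp [M.lact_ract, mk_bal])

/-- The right action `(m ⊗ n) g = m ⊗ n g`. -/
def balRact (M N : GradedBimod k d) (g : G) : Bal M N →ₗ[k] Bal M N :=
  balLift ((tmk M N).compl₂ (N.ract g)) (fun h m n => by simp [N.lact_ract, mk_bal])

@[simp]
theorem balLact_mk (M N : GradedBimod k d) (g : G) (m : M.carrier) (n : N.carrier) :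
    balLact M N g (tmk M N m n) = tmk M N (M.lact g m) n :=
  balLift_mk _ _ _ _

@[simp]
theorem balRact_mk (M N : GradedBimod k d) (g : G) (m : M.carrier) (n : N.carrier) :
    balRact M N g (tmk M N m n) = tmk M N m (N.ract g n) :=
  balLift_mk _ _ _ _

/-- The tensor product of two graded bimodules. -/
def tensor (M N : GradedBimod k d) : GradedBimod k d where
  carrier := Bal M N
  lact := balLact M N
  ract := balRact M N
  lact_one := LinearMap.congr_fun (f := balLact M N 1) (g := LinearMap.id)
    (bal_ext fun m n => by simp [M.lact_one])
  ract_one := LinearMap.congr_fun (f := balRact M N 1) (g := LinearMap.id)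
    (bal_ext fun m n => by simp [N.ract_one])
  lact_mul g h := LinearMap.congr_fun (f := balLact M N (g * h))
    (g := balLact M N g ∘ₗ balLact M N h) (bal_ext fun m n => by simp [M.lact_mul])
  ract_mul g h := LinearMap.congr_fun (f := balRact M N (g * h))
    (g := balRact M N h ∘ₗ balRact M N g) (bal_ext fun m n => by simp [N.ract_mul])
  lact_ract g h := LinearMap.congr_fun (f := balLact M N g ∘ₗ balRact M N h)
    (g := balRact M N h ∘ₗ balLact M N g) (bal_ext fun m n => by simp)
  deg := balDeg M N
  deg_indep := indep_of_coaction _ (balCoaction M N) (by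
    intro c x hx
    have h0 := balDeg_le (balCoaction M N - Finsupp.lsingle c) c ⊥ (fun a b m n hm hn hc => by
      rw [Submodule.mem_bot, LinearMap.sub_apply, balCoaction_mk hm hn, hc]
      simp) x hx
    rw [Submodule.mem_bot, LinearMap.sub_apply, sub_eq_zero] at h0
    simpa using h0)
  deg_iSup := by
    have : (⨆ c, balDeg M N c).mkQ = 0 := bal_ext_deg fun a m hm b n hn => by
      rw [LinearMap.zero_apply, Submodule.mkQ_apply, Submodule.Quotient.mk_eq_zero]
      exact Submodule.mem_iSup_of_mem (a * b) (mk_mem hm hn rfl)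
    rw [← Submodule.ker_mkQ (⨆ c, balDeg M N c), this, LinearMap.ker_zero]
  lact_mem g c := balDeg_le _ _ _ (fun a b m n hm hn hc => by
    simpa using mk_mem (M.lact_mem g a m hm) hn (by rw [← hc, mul_assoc]))
  ract_mem g c := balDeg_le _ _ _ (fun a b m n hm hn hc => by
    simpa using mk_mem hm (N.ract_mem g b n hn) (by rw [← hc, mul_assoc]))

/-- The universal bilinear map `(m, n) ↦ m ⊗ n`. -/
def tmul (M N : GradedBimod k d) : M.carrier →ₗ[k] N.carrier →ₗ[k] (tensor M N).carrier := tmk M N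

/-- The universal property of the tensor product over `k[G]`. -/
def lift {M N : GradedBimod k d} {P : Type*} [AddCommGroup P] [Module k P]
    (f : M.carrier →ₗ[k] N.carrier →ₗ[k] P)
    (hf : ∀ g m n, f (M.ract g m) n = f m (N.lact g n)) : (tensor M N).carrier →ₗ[k] P :=
  balLift f hf

@[simp]
theorem lift_tmul {M N : GradedBimod k d} {P : Type*} [AddCommGroup P] [Module k P]
    (f : M.carrier →ₗ[k] N.carrier →ₗ[k] P)
    (hf : ∀ g m n, f (M.ract g m) n = f m (N.lact g n)) (m : M.carrier) (n : N.carrier) :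
    lift f hf (tmul M N m n) = f m n := balLift_mk f hf m n

theorem tmul_bal {M N : GradedBimod k d} (g : G) (m : M.carrier) (n : N.carrier) :
    tmul M N (M.ract g m) n = tmul M N m (N.lact g n) := mk_bal g m n

@[simp]
theorem tensor_lact {M N : GradedBimod k d} (g : G) (m : M.carrier) (n : N.carrier) :
    (tensor M N).lact g (tmul M N m n) = tmul M N (M.lact g m) n := balLact_mk M N g m n

@[simp]
theorem tensor_ract {M N : GradedBimod k d} (g : G) (m : M.carrier) (n : N.carrier) :
    (tensor M N).ract g (tmul M N m n) = tmul M N m (N.ract g n) := balRact_mk M N g m n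

theorem tmul_mem {M N : GradedBimod k d} {a b c : B} {m : M.carrier} {n : N.carrier}
    (hm : m ∈ M.deg a) (hn : n ∈ N.deg b) (h : a * b = c) : tmul M N m n ∈ (tensor M N).deg c :=
  mk_mem hm hn h

theorem tensor_deg_le {M N : GradedBimod k d} {P : Type*} [AddCommGroup P] [Module k P]
    (f : (tensor M N).carrier →ₗ[k] P) (c : B) (S : Submodule k P)
    (h : ∀ a b m n, m ∈ M.deg a → n ∈ N.deg b → a * b = c → f (tmul M N m n) ∈ S)
    (x : (tensor M N).carrier) (hx : x ∈ (tensor M N).deg c) : f x ∈ S :=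
  balDeg_le f c S h x hx

theorem tensor_ext {M N : GradedBimod k d} {P : Type*} [AddCommGroup P] [Module k P]
    {f g : (tensor M N).carrier →ₗ[k] P} (h : ∀ m n, f (tmul M N m n) = g (tmul M N m n)) :
    f = g := bal_ext h

theorem tensor_ext_deg {M N : GradedBimod k d} {P : Type*} [AddCommGroup P] [Module k P]
    {f g : (tensor M N).carrier →ₗ[k] P}
    (h : ∀ a, ∀ m ∈ M.deg a, ∀ b, ∀ n ∈ N.deg b, f (tmul M N m n) = g (tmul M N m n)) : f = g :=
  bal_ext_deg h

theorem tensor_induction {M N : GradedBimod k d} {p : (tensor M N).carrier → Prop}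
    (hmk : ∀ m n, p (tmul M N m n)) (hadd : ∀ x y, p x → p y → p (x + y))
    (x : (tensor M N).carrier) : p x := bal_induction hmk hadd x

/-- The unit object: `k[G]` as a bimodule over itself, with `g` in degree `d g`. -/
def unit (k : Type u) [Field k] {G : Type u} [Group G] {B : Type w} [CommGroup B]
    (d : G →* B) : GradedBimod k d where
  carrier := MonoidAlgebra k G
  lact g := LinearMap.mulLeft k (MonoidAlgebra.single g 1)
  ract g := LinearMap.mulRight k (MonoidAlgebra.single g 1)
  lact_one m := by simp [← MonoidAlgebra.one_def]
  lact_mul g h m := by simp [← mul_assoc, MonoidAlgebra.single_mul_single]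
  ract_one m := by simp [← MonoidAlgebra.one_def]
  ract_mul g h m := by simp [mul_assoc, MonoidAlgebra.single_mul_single]
  lact_ract g h m := by simp [mul_assoc]
  deg b := Submodule.span k {x | ∃ g, d g = b ∧ x = MonoidAlgebra.single g 1}
  deg_indep := indep_of_coaction _
    ((MonoidAlgebra.basis G k).constr k fun g =>
      Finsupp.single (d g) (MonoidAlgebra.single g (1 : k))) (by
      intro b x hx
      induction hx using Submodule.span_induction with
      | mem x hx =>
        obtain ⟨g, rfl, rfl⟩ := hx
        have := (MonoidAlgebra.basis G k).constr_basis k (fun g =>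
          Finsupp.single (d g) (MonoidAlgebra.single g (1 : k))) g
        simpa using this
      | zero => simp
      | add x y _ _ hx hy => rw [map_add, hx, hy, Finsupp.single_add]
      | smul c x _ hx => rw [map_smul, hx, Finsupp.smul_single])
  deg_iSup := by
    rw [eq_top_iff, ← (MonoidAlgebra.basis G k).span_eq, Submodule.span_le]
    rintro _ ⟨g, rfl⟩
    exact Submodule.mem_iSup_of_mem (d g) (Submodule.subset_span ⟨g, rfl, by simp⟩)
  lact_mem g b m hm := by
    induction hm using Submodule.span_induction with
    | mem x hx =>
      obtain ⟨h, rfl, rfl⟩ := hx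
      exact Submodule.subset_span ⟨g * h, by simp, by simp [MonoidAlgebra.single_mul_single]⟩
    | zero => simp
    | add x y _ _ hx hy => rw [map_add]; exact add_mem hx hy
    | smul c x _ hx => rw [map_smul]; exact Submodule.smul_mem _ _ hx
  ract_mem g b m hm := by
    induction hm using Submodule.span_induction with
    | mem x hx =>
      obtain ⟨h, rfl, rfl⟩ := hx
      exact Submodule.subset_span ⟨h * g, by simp, by simp [MonoidAlgebra.single_mul_single]⟩
    | zero => simp
    | add x y _ _ hx hy => rw [map_add]; exact add_mem hx hy
    | smul c x _ hx => rw [map_smul]; exact Submodule.smul_mem _ _ hx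

/-- The element `g` of the unit object `k[G]`. -/
def grp (d : G →* B) (g : G) : (unit k d).carrier := MonoidAlgebra.single g (1 : k)

/-- A linear map on `k[G]` given by its values on the elements of `G`. -/
def unitLift {P : Type*} [AddCommGroup P] [Module k P] (f : G → P) : (unit k d).carrier →ₗ[k] P :=
  (MonoidAlgebra.basis G k).constr k f

@[simp]
theorem unitLift_grp {P : Type*} [AddCommGroup P] [Module k P] (f : G → P) (g : G) :
    unitLift f (grp (k := k) d g) = f g := by
  have := (MonoidAlgebra.basis G k).constr_basis k f g
  rw [MonoidAlgebra.basis_apply] at this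
  exact this

theorem unit_ext {P : Type*} [AddCommGroup P] [Module k P] {f g : (unit k d).carrier →ₗ[k] P}
    (h : ∀ x, f (grp d x) = g (grp d x)) : f = g :=
  (MonoidAlgebra.basis G k).ext fun x => by
    rw [MonoidAlgebra.basis_apply]
    exact h x

@[simp]
theorem unit_lact (g h : G) : (unit k d).lact g (grp d h) = grp d (g * h) := by
  have : MonoidAlgebra.single g (1 : k) * MonoidAlgebra.single h 1 =
      MonoidAlgebra.single (g * h) 1 := by
    simp [MonoidAlgebra.single_mul_single]
  exact this

@[simp]
theorem unit_ract (g h : G) : (unit k d).ract g (grp d h) = grp d (h * g) := by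
  have : MonoidAlgebra.single h (1 : k) * MonoidAlgebra.single g 1 =
      MonoidAlgebra.single (h * g) 1 := by
    simp [MonoidAlgebra.single_mul_single]
  exact this

theorem grp_mem (g : G) : grp (k := k) d g ∈ (unit k d).deg (d g) := by
  exact Submodule.subset_span (R := k) (M := MonoidAlgebra k G) ⟨g, rfl, rfl⟩

theorem unit_deg_le {P : Type*} [AddCommGroup P] [Module k P] (f : (unit k d).carrier →ₗ[k] P)
    (b : B) (S : Submodule k P) (h : ∀ g, d g = b → f (grp d g) ∈ S) (x : (unit k d).carrier)
    (hx : x ∈ (unit k d).deg b) : f x ∈ S := by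
  have : (unit k d).deg b ≤ S.comap f := by
    refine Submodule.span_le.2 ?_
    rintro _ ⟨g, hg, rfl⟩
    exact h g hg
  exact this hx

/-! ### The monoidal category of graded bimodules -/

/-- The linear map `m ⊗ n ↦ f m ⊗ g n`. -/
def tensorMapLin {M M' N N' : GradedBimod k d} (f : M ⟶ M') (g : N ⟶ N') :
    (tensor M N).carrier →ₗ[k] (tensor M' N').carrier :=
  lift ((tmul M' N').compl₁₂ f.toLin g.toLin) (fun a m n => by
    simp [f.map_ract, g.map_lact, tmul_bal])

@[simp]
theorem tensorMapLin_tmul {M M' N N' : GradedBimod k d} (f : M ⟶ M') (g : N ⟶ N')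
    (m : M.carrier) (n : N.carrier) :
    tensorMapLin f g (tmul M N m n) = tmul M' N' (f.toLin m) (g.toLin n) :=
  lift_tmul _ _ _ _

/-- The tensor product of two morphisms. -/
def tensorMap {M M' N N' : GradedBimod k d} (f : M ⟶ M') (g : N ⟶ N') :
    tensor M N ⟶ tensor M' N' where
  toLin := tensorMapLin f g
  map_lact a x := by
    induction x using tensor_induction with
    | hmk m n => simp [f.map_lact]
    | hadd x y hx hy => simp only [map_add, hx, hy]
  map_ract a x := by
    induction x using tensor_induction with
    | hmk m n => simp [g.map_ract]
    | hadd x y hx hy => simp only [map_add, hx, hy]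
  map_deg c := tensor_deg_le _ _ _ (fun a b m n hm hn hc => by
    simpa using tmul_mem (f.map_deg a m hm) (g.map_deg b n hn) hc)

@[simp]
theorem tensorMap_tmul {M M' N N' : GradedBimod k d} (f : M ⟶ M') (g : N ⟶ N')
    (m : M.carrier) (n : N.carrier) :
    (tensorMap f g).toLin (tmul M N m n) = tmul M' N' (f.toLin m) (g.toLin n) :=
  tensorMapLin_tmul f g m n

theorem tensor_ext₃ {M N P : GradedBimod k d} {Q : Type*} [AddCommGroup Q] [Module k Q]
    {f g : (tensor (tensor M N) P).carrier →ₗ[k] Q}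
    (h : ∀ m n p, f (tmul (tensor M N) P (tmul M N m n) p) =
      g (tmul (tensor M N) P (tmul M N m n) p)) : f = g := by
  have : (tmul (tensor M N) P).compr₂ f = (tmul (tensor M N) P).compr₂ g :=
    tensor_ext fun m n => LinearMap.ext (h m n)
  exact tensor_ext fun x p => LinearMap.congr_fun₂ this x p

theorem tensor_ext₃' {M N P : GradedBimod k d} {Q : Type*} [AddCommGroup Q] [Module k Q]
    {f g : (tensor M (tensor N P)).carrier →ₗ[k] Q}
    (h : ∀ m n p, f (tmul M (tensor N P) m (tmul N P n p)) =
      g (tmul M (tensor N P) m (tmul N P n p))) : f = g :=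
  tensor_ext fun m x => LinearMap.congr_fun (f := f ∘ₗ tmul M (tensor N P) m)
    (g := g ∘ₗ tmul M (tensor N P) m) (tensor_ext (h m)) x

theorem tensor_ext₄ {M N P Q : GradedBimod k d} {X : Type*} [AddCommGroup X] [Module k X]
    {f g : (tensor (tensor (tensor M N) P) Q).carrier →ₗ[k] X}
    (h : ∀ m n p q,
      f (tmul (tensor (tensor M N) P) Q (tmul (tensor M N) P (tmul M N m n) p) q) =
        g (tmul (tensor (tensor M N) P) Q (tmul (tensor M N) P (tmul M N m n) p) q)) :
    f = g := by
  have : (tmul (tensor (tensor M N) P) Q).compr₂ f = (tmul (tensor (tensor M N) P) Q).compr₂ g :=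
    tensor_ext₃ fun m n p => LinearMap.ext (h m n p)
  exact tensor_ext fun x p => LinearMap.congr_fun₂ this x p

/-- Auxiliary to the associator: `m ⊗ n ↦ (p ↦ m ⊗ (n ⊗ p))`. -/
def assocAux (M N P : GradedBimod k d) :
    (tensor M N).carrier →ₗ[k] P.carrier →ₗ[k] (tensor M (tensor N P)).carrier :=
  lift (LinearMap.mk₂ k (fun m n => tmul M (tensor N P) m ∘ₗ tmul N P n)
      (by intros; ext; simp) (by intros; ext; simp) (by intros; ext; simp) (by intros; ext; simp))
    (fun g m n => by
      ext p
      simp [tmul_bal])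

@[simp]
theorem assocAux_tmul (M N P : GradedBimod k d) (m : M.carrier) (n : N.carrier) (p : P.carrier) :
    assocAux M N P (tmul M N m n) p = tmul M (tensor N P) m (tmul N P n p) := by
  rw [assocAux, lift_tmul]
  rfl

/-- The associator `(m ⊗ n) ⊗ p ↦ m ⊗ (n ⊗ p)`. -/
def assocLin (M N P : GradedBimod k d) :
    (tensor (tensor M N) P).carrier →ₗ[k] (tensor M (tensor N P)).carrier :=
  lift (assocAux M N P) (fun g x p => by
    induction x using tensor_induction with
    | hmk m n => simp [tmul_bal]
    | hadd x y hx hy => simp only [map_add, LinearMap.add_apply, hx, hy])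

@[simp]
theorem assocLin_tmul (M N P : GradedBimod k d) (m : M.carrier) (n : N.carrier) (p : P.carrier) :
    assocLin M N P (tmul (tensor M N) P (tmul M N m n) p) =
      tmul M (tensor N P) m (tmul N P n p) := by
  rw [assocLin, lift_tmul, assocAux_tmul]

/-- Auxiliary to the inverse associator: `n ⊗ p ↦ (m ↦ (m ⊗ n) ⊗ p)`. -/
def assocInvAux (M N P : GradedBimod k d) :
    (tensor N P).carrier →ₗ[k] M.carrier →ₗ[k] (tensor (tensor M N) P).carrier :=
  lift (LinearMap.mk₂ k
      (fun n p => (tmul (tensor M N) P).flip p ∘ₗ (tmul M N).flip n)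
      (by intros; ext; simp) (by intros; ext; simp) (by intros; ext; simp) (by intros; ext; simp))
    (fun g n p => by
      ext m
      simp [← tmul_bal])

@[simp]
theorem assocInvAux_tmul (M N P : GradedBimod k d) (m : M.carrier) (n : N.carrier)
    (p : P.carrier) :
    assocInvAux M N P (tmul N P n p) m = tmul (tensor M N) P (tmul M N m n) p := by
  rw [assocInvAux, lift_tmul]
  rfl

/-- The inverse associator `m ⊗ (n ⊗ p) ↦ (m ⊗ n) ⊗ p`. -/
def assocInvLin (M N P : GradedBimod k d) :
    (tensor M (tensor N P)).carrier →ₗ[k] (tensor (tensor M N) P).carrier :=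
  lift (assocInvAux M N P).flip (fun g m x => by
    induction x using tensor_induction with
    | hmk n p => simp [tmul_bal]
    | hadd x y hx hy => simp only [map_add, hx, hy])

@[simp]
theorem assocInvLin_tmul (M N P : GradedBimod k d) (m : M.carrier) (n : N.carrier)
    (p : P.carrier) :
    assocInvLin M N P (tmul M (tensor N P) m (tmul N P n p)) =
      tmul (tensor M N) P (tmul M N m n) p := by
  rw [assocInvLin, lift_tmul, LinearMap.flip_apply, assocInvAux_tmul]

/-- The associator. -/
def assoc (M N P : GradedBimod k d) : tensor (tensor M N) P ≅ tensor M (tensor N P) where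
  hom :=
    { toLin := assocLin M N P
      map_lact := fun g => LinearMap.congr_fun
        (f := assocLin M N P ∘ₗ (tensor (tensor M N) P).lact g)
        (g := (tensor M (tensor N P)).lact g ∘ₗ assocLin M N P) (tensor_ext₃ fun m n p => by simp)
      map_ract := fun g => LinearMap.congr_fun
        (f := assocLin M N P ∘ₗ (tensor (tensor M N) P).ract g)
        (g := (tensor M (tensor N P)).ract g ∘ₗ assocLin M N P) (tensor_ext₃ fun m n p => by simp)
      map_deg := fun c => tensor_deg_le _ _ _ (fun a b x p hx hp hc => by
        have := tensor_deg_le ((tmul (tensor M N) P).compr₂ (assocLin M N P) |>.flip p) a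
          ((tensor M (tensor N P)).deg c) (fun a' b' m n hm hn ha => by
            simpa using tmul_mem hm (tmul_mem hn hp rfl) (by rw [← hc, ← ha, mul_assoc])) x hx
        simpa using this) }
  inv :=
    { toLin := assocInvLin M N P
      map_lact := fun g => LinearMap.congr_fun
        (f := assocInvLin M N P ∘ₗ (tensor M (tensor N P)).lact g)
        (g := (tensor (tensor M N) P).lact g ∘ₗ assocInvLin M N P)
        (tensor_ext₃' fun m n p => by simp)
      map_ract := fun g => LinearMap.congr_fun
        (f := assocInvLin M N P ∘ₗ (tensor M (tensor N P)).ract g)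
        (g := (tensor (tensor M N) P).ract g ∘ₗ assocInvLin M N P)
        (tensor_ext₃' fun m n p => by simp)
      map_deg := fun c => tensor_deg_le _ _ _ (fun a b m x hm hx hc => by
        have := tensor_deg_le (assocInvLin M N P ∘ₗ tmul M (tensor N P) m) b
          ((tensor (tensor M N) P).deg c) (fun a' b' n p hn hp hb => by
            simpa using tmul_mem (tmul_mem hm hn rfl) hp (by rw [← hc, ← hb, mul_assoc])) x hx
        simpa using this) }
  hom_inv_id := hom_ext (tensor_ext₃ fun m n p => by simp)
  inv_hom_id := hom_ext (tensor_ext₃' fun m n p => by simp)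

theorem tmul_grp_left (M : GradedBimod k d) (g : G) (m : M.carrier) :
    tmul (unit k d) M (grp d g) m = tmul (unit k d) M (grp d 1) (M.lact g m) := by
  rw [← tmul_bal]
  simp

theorem tmul_grp_right (M : GradedBimod k d) (g : G) (m : M.carrier) :
    tmul M (unit k d) m (grp d g) = tmul M (unit k d) (M.ract g m) (grp d 1) := by
  rw [tmul_bal]
  simp

theorem unitLift_lact (M : GradedBimod k d) (g : G) (r : (unit k d).carrier) (m : M.carrier) :
    unitLift M.lact ((unit k d).ract g r) m = unitLift M.lact r (M.lact g m) := by
  have := unit_ext (f := unitLift M.lact ∘ₗ (unit k d).ract g)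
    (g := (unitLift M.lact).compl₂ (M.lact g)) (fun h => by ext m; simp [M.lact_mul])
  simpa using LinearMap.congr_fun₂ this r m

theorem unitLift_ract (M : GradedBimod k d) (g : G) (m : M.carrier) (r : (unit k d).carrier) :
    (unitLift M.ract).flip (M.ract g m) r = (unitLift M.ract).flip m ((unit k d).lact g r) := by
  have := unit_ext (f := unitLift M.ract ∘ₗ (unit k d).lact g)
    (g := (unitLift M.ract).compl₂ (M.ract g)) (fun h => by ext m; simp [M.ract_mul])
  simpa using (LinearMap.congr_fun₂ this r m).symm

/-- The map `k[G] ⊗ M → M`, `r ⊗ m ↦ r m`. -/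
def leftUnitorLin (M : GradedBimod k d) : (tensor (unit k d) M).carrier →ₗ[k] M.carrier :=
  lift (unitLift M.lact) (unitLift_lact M)

@[simp]
theorem leftUnitorLin_tmul (M : GradedBimod k d) (g : G) (m : M.carrier) :
    leftUnitorLin M (tmul (unit k d) M (grp d g) m) = M.lact g m := by
  rw [leftUnitorLin, lift_tmul, unitLift_grp]

/-- The map `M ⊗ k[G] → M`, `m ⊗ r ↦ m r`. -/
def rightUnitorLin (M : GradedBimod k d) : (tensor M (unit k d)).carrier →ₗ[k] M.carrier :=
  lift (unitLift M.ract).flip (unitLift_ract M)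

@[simp]
theorem rightUnitorLin_tmul (M : GradedBimod k d) (g : G) (m : M.carrier) :
    rightUnitorLin M (tmul M (unit k d) m (grp d g)) = M.ract g m := by
  rw [rightUnitorLin, lift_tmul, LinearMap.flip_apply, unitLift_grp]

theorem unit_left_ext {M : GradedBimod k d} {P : Type*} [AddCommGroup P] [Module k P]
    {f g : (tensor (unit k d) M).carrier →ₗ[k] P}
    (h : ∀ m, f (tmul _ M (grp d 1) m) = g (tmul _ M (grp d 1) m)) : f = g := by
  have : (tmul (unit k d) M).compr₂ f = (tmul (unit k d) M).compr₂ g :=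
    unit_ext fun x => by
      ext m
      simp only [LinearMap.compr₂_apply]
      rw [tmul_grp_left, h]
  exact tensor_ext fun m n => LinearMap.congr_fun₂ this m n

theorem unit_right_ext {M : GradedBimod k d} {P : Type*} [AddCommGroup P] [Module k P]
    {f g : (tensor M (unit k d)).carrier →ₗ[k] P}
    (h : ∀ m, f (tmul M _ m (grp d 1)) = g (tmul M _ m (grp d 1))) : f = g := by
  have : ((tmul M (unit k d)).compr₂ f).flip = ((tmul M (unit k d)).compr₂ g).flip :=
    unit_ext fun x => by
      ext m
      simp only [LinearMap.compr₂_apply, LinearMap.flip_apply]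
      rw [tmul_grp_right, h]
  exact tensor_ext fun m n => LinearMap.congr_fun₂ this n m

theorem grp_one_mem : grp (k := k) d 1 ∈ (unit k d).deg 1 := by
  simpa using grp_mem (k := k) (d := d) 1

/-- The left unitor. -/
def leftUnit (M : GradedBimod k d) : tensor (unit k d) M ≅ M where
  hom :=
    { toLin := leftUnitorLin M
      map_lact := fun g => LinearMap.congr_fun (f := leftUnitorLin M ∘ₗ (tensor _ M).lact g)
        (g := M.lact g ∘ₗ leftUnitorLin M)
        (unit_left_ext fun m => by simp [M.lact_one])
      map_ract := fun g => LinearMap.congr_fun (f := leftUnitorLin M ∘ₗ (tensor _ M).ract g)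
        (g := M.ract g ∘ₗ leftUnitorLin M)
        (unit_left_ext fun m => by simp [M.lact_one])
      map_deg := fun c => tensor_deg_le _ _ _ (fun a b r m hr hm hc =>
        unit_deg_le (leftUnitorLin M ∘ₗ (tmul _ M).flip m) a (M.deg c) (fun g hg => by
          simpa [← hc, ← hg] using M.lact_mem g b m hm) r hr) }
  inv :=
    { toLin := tmul (unit k d) M (grp d 1)
      map_lact := fun g m => by simp [← tmul_grp_left]
      map_ract := fun g m => by simp
      map_deg := fun b m hm => tmul_mem grp_one_mem hm (one_mul b) }
  hom_inv_id := hom_ext (unit_left_ext fun m => by simp [M.lact_one])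
  inv_hom_id := hom_ext (by ext m; simp [M.lact_one])

/-- The right unitor. -/
def rightUnit (M : GradedBimod k d) : tensor M (unit k d) ≅ M where
  hom :=
    { toLin := rightUnitorLin M
      map_lact := fun g => LinearMap.congr_fun (f := rightUnitorLin M ∘ₗ (tensor M _).lact g)
        (g := M.lact g ∘ₗ rightUnitorLin M)
        (unit_right_ext fun m => by simp [M.ract_one])
      map_ract := fun g => LinearMap.congr_fun (f := rightUnitorLin M ∘ₗ (tensor M _).ract g)
        (g := M.ract g ∘ₗ rightUnitorLin M)
        (unit_right_ext fun m => by simp [M.ract_one])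
      map_deg := fun c => tensor_deg_le _ _ _ (fun a b m r hm hr hc =>
        unit_deg_le (rightUnitorLin M ∘ₗ tmul M _ m) b (M.deg c) (fun g hg => by
          simpa [← hc, ← hg] using M.ract_mem g a m hm) r hr) }
  inv :=
    { toLin := (tmul M (unit k d)).flip (grp d 1)
      map_lact := fun g m => by simp
      map_ract := fun g m => by simp [← tmul_grp_right]
      map_deg := fun b m hm => tmul_mem hm grp_one_mem (mul_one b) }
  hom_inv_id := hom_ext (unit_right_ext fun m => by simp [M.ract_one])
  inv_hom_id := hom_ext (by ext m; simp [M.ract_one])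

theorem tensorMap_id (X Y : GradedBimod k d) : tensorMap (𝟙 X) (𝟙 Y) = 𝟙 (tensor X Y) :=
  hom_ext (tensor_ext fun x y => by simp)

theorem tensorMap_comp {X₁ Y₁ Z₁ X₂ Y₂ Z₂ : GradedBimod k d} (f₁ : X₁ ⟶ Y₁) (f₂ : X₂ ⟶ Y₂)
    (g₁ : Y₁ ⟶ Z₁) (g₂ : Y₂ ⟶ Z₂) :
    tensorMap f₁ f₂ ≫ tensorMap g₁ g₂ = tensorMap (f₁ ≫ g₁) (f₂ ≫ g₂) :=
  hom_ext (tensor_ext fun x y => by simp)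

theorem assoc_naturality {X₁ X₂ X₃ Y₁ Y₂ Y₃ : GradedBimod k d} (f₁ : X₁ ⟶ Y₁) (f₂ : X₂ ⟶ Y₂)
    (f₃ : X₃ ⟶ Y₃) : tensorMap (tensorMap f₁ f₂) f₃ ≫ (assoc Y₁ Y₂ Y₃).hom =
      (assoc X₁ X₂ X₃).hom ≫ tensorMap f₁ (tensorMap f₂ f₃) :=
  hom_ext (tensor_ext₃ fun x y z => by simp [assoc])

theorem leftUnit_naturality {X Y : GradedBimod k d} (f : X ⟶ Y) :
    tensorMap (𝟙 (unit k d)) f ≫ (leftUnit Y).hom = (leftUnit X).hom ≫ f :=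
  hom_ext (unit_left_ext fun x => by simp [leftUnit, f.map_lact])

theorem rightUnit_naturality {X Y : GradedBimod k d} (f : X ⟶ Y) :
    tensorMap f (𝟙 (unit k d)) ≫ (rightUnit Y).hom = (rightUnit X).hom ≫ f :=
  hom_ext (unit_right_ext fun x => by simp [rightUnit, f.map_ract])

theorem assoc_pentagon (W X Y Z : GradedBimod k d) :
    tensorMap (assoc W X Y).hom (𝟙 Z) ≫ (assoc W (tensor X Y) Z).hom ≫
      tensorMap (𝟙 W) (assoc X Y Z).hom =
        (assoc (tensor W X) Y Z).hom ≫ (assoc W X (tensor Y Z)).hom :=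
  hom_ext (tensor_ext₄ fun w x y z => by simp [assoc])

theorem assoc_triangle (X Y : GradedBimod k d) :
    (assoc X (unit k d) Y).hom ≫ tensorMap (𝟙 X) (leftUnit Y).hom =
      tensorMap (rightUnit X).hom (𝟙 Y) :=
  hom_ext (tensor_ext fun xr y => by
    have := unit_right_ext (f := (tensorMap (𝟙 X) (leftUnit Y).hom).toLin ∘ₗ
        assocLin X (unit k d) Y ∘ₗ (tmul _ Y).flip y)
      (g := (tensorMap (rightUnit X).hom (𝟙 Y)).toLin ∘ₗ (tmul _ Y).flip y) (fun x => by
        simp [leftUnit, rightUnit, X.ract_one, Y.lact_one])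
    exact LinearMap.congr_fun this xr)

/-- The monoidal category of `B`-graded `k[G]`-bimodules, with product `⊗_{k[G]}`. -/
instance : MonoidalCategory (GradedBimod k d) where
  tensorObj := tensor
  whiskerLeft X _ _ f := tensorMap (𝟙 X) f
  whiskerRight f Y := tensorMap f (𝟙 Y)
  tensorHom := tensorMap
  tensorUnit := unit k d
  associator := assoc
  leftUnitor := leftUnit
  rightUnitor := rightUnit
  tensorHom_def f g := (tensorMap_comp f (𝟙 _) (𝟙 _) g).symm
  id_tensorHom_id := tensorMap_id
  tensorHom_comp_tensorHom := tensorMap_comp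
  whiskerLeft_id := tensorMap_id
  id_whiskerRight := tensorMap_id
  associator_naturality := assoc_naturality
  leftUnitor_naturality := leftUnit_naturality
  rightUnitor_naturality := rightUnit_naturality
  pentagon := assoc_pentagon
  triangle := assoc_triangle

end GradedBimod

/-! ### Bicharacters and the braiding -/

/-- An antisymmetric bicharacter `ε : B × B → kˣ`. -/
structure AntisymmBicharacter (k : Type u) [Field k] (B : Type w) [CommGroup B] where
  toFun : B → B → kˣ
  map_mul_right : ∀ a b c, toFun a (b * c) = toFun a b * toFun a c
  map_mul_left : ∀ a b c, toFun (a * b) c = toFun a c * toFun b c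
  antisymm : ∀ a b, toFun b a = (toFun a b)⁻¹

/-- An antisymmetric bicharacter for which the group algebra of `G`, graded through `d : G →* B`,
is `ε`-commutative: `ε(|g|, |h|) = 1` for `g, h` in `G`. -/
structure ColorFactor (k : Type u) [Field k] {G : Type u} [CommGroup G] {B : Type w} [CommGroup B]
    (d : G →* B) extends AntisymmBicharacter k B where
  map_group : ∀ g h, toFun (d g) (d h) = 1

namespace GradedBimod

variable {k : Type u} [Field k] {G : Type u} [CommGroup G] {B : Type w} [CommGroup B] {d : G →* B}

/-- The graded bimodules with `g m = ε(|g|, |m|) m g` for `g` in `G` and `m` homogeneous: the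
bimodules for which `m ⊗ n ↦ ε(|m|, |n|) n ⊗ m` is well defined on tensor products over `k[G]`. -/
def IsColor (ε : ColorFactor k d) : ObjectProperty (GradedBimod k d) := fun M =>
  ∀ g b m, m ∈ M.deg b → M.lact g m = (ε.toFun (d g) b : k) • M.ract g m

theorem isColor_unit (ε : ColorFactor k d) : IsColor ε (unit k d) := by
  intro g b m hm
  have := unit_deg_le ((unit k d).lact g - (ε.toFun (d g) b : k) • (unit k d).ract g) b ⊥
    (fun h hb => by
      rw [Submodule.mem_bot]
      simp [← hb, ε.map_group, mul_comm g h]) m hm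
  rw [Submodule.mem_bot, LinearMap.sub_apply, sub_eq_zero] at this
  simpa using this

theorem isColor_tensor (ε : ColorFactor k d) (M N : GradedBimod k d) (hM : IsColor ε M)
    (hN : IsColor ε N) : IsColor ε (tensor M N) := by
  intro g c x hx
  have := tensor_deg_le ((tensor M N).lact g - (ε.toFun (d g) c : k) • (tensor M N).ract g) c ⊥
    (fun a b m n hm hn hc => by
      rw [Submodule.mem_bot]
      simp [hM g a m hm, tmul_bal, hN g b n hn, ← hc, ε.map_mul_right, mul_smul]) x hx
  rw [Submodule.mem_bot, LinearMap.sub_apply, sub_eq_zero] at this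
  simpa using this

instance (ε : ColorFactor k d) : (IsColor ε).IsMonoidal where
  prop_unit := isColor_unit ε
  prop_tensor := isColor_tensor ε

/-- The linear map `m ⊗ n ↦ ε(|m|, |n|) n ⊗ m`. -/
def braidLin (ε : ColorFactor k d) {M N : GradedBimod k d} (hM : IsColor ε M)
    (hN : IsColor ε N) : (tensor M N).carrier →ₗ[k] (tensor N M).carrier :=
  lift (gradedLift₂ M N fun a b => (ε.toFun a b : k) • (tmul N M).flip)
    (balanced_of_deg _ fun g a m b n hm hn => by
      rw [gradedLift₂_of_mem _ (M.ract_mem g a m hm) hn,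
        gradedLift₂_of_mem _ hm (N.lact_mem g b n hn)]
      simp only [LinearMap.smul_apply, LinearMap.flip_apply]
      rw [hN g b n hn, map_smul, LinearMap.smul_apply, tmul_bal, hM g a m hm, map_smul,
        smul_smul, smul_smul]
      congr 1
      rw [ε.map_mul_left, ε.map_mul_right, ε.antisymm a (d g)]
      push_cast
      field_simp)

theorem braidLin_tmul (ε : ColorFactor k d) {M N : GradedBimod k d} (hM : IsColor ε M)
    (hN : IsColor ε N) {a b : B} {m : M.carrier} {n : N.carrier} (hm : m ∈ M.deg a)
    (hn : n ∈ N.deg b) :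
    braidLin ε hM hN (tmul M N m n) = (ε.toFun a b : k) • tmul N M n m := by
  rw [braidLin, lift_tmul, gradedLift₂_of_mem _ hm hn]
  rfl

theorem braidLin_braidLin (ε : ColorFactor k d) {M N : GradedBimod k d} (hM : IsColor ε M)
    (hN : IsColor ε N) : braidLin ε hN hM ∘ₗ braidLin ε hM hN = LinearMap.id :=
  tensor_ext_deg fun a m hm b n hn => by
    rw [LinearMap.comp_apply, braidLin_tmul ε hM hN hm hn, map_smul, braidLin_tmul ε hN hM hn hm,
      ε.antisymm a b]
    simp

/-- The morphism `τ : M ⊗ N ⟶ N ⊗ M`, `τ(m ⊗ n) = ε(|m|, |n|) n ⊗ m`. -/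
def braid (ε : ColorFactor k d) {M N : GradedBimod k d} (hM : IsColor ε M)
    (hN : IsColor ε N) : tensor M N ⟶ tensor N M where
  toLin := braidLin ε hM hN
  map_lact g := LinearMap.congr_fun (f := braidLin ε hM hN ∘ₗ (tensor M N).lact g)
    (g := (tensor N M).lact g ∘ₗ braidLin ε hM hN) (tensor_ext_deg fun a m hm b n hn => by
      simp only [LinearMap.comp_apply, tensor_lact]
      rw [braidLin_tmul ε hM hN (M.lact_mem g a m hm) hn, braidLin_tmul ε hM hN hm hn, map_smul,
        tensor_lact, ← tmul_bal, hN g b n hn, map_smul, LinearMap.smul_apply, smul_smul,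
        ε.map_mul_left]
      congr 1
      push_cast
      ring)
  map_ract g := LinearMap.congr_fun (f := braidLin ε hM hN ∘ₗ (tensor M N).ract g)
    (g := (tensor N M).ract g ∘ₗ braidLin ε hM hN) (tensor_ext_deg fun a m hm b n hn => by
      simp only [LinearMap.comp_apply, tensor_ract]
      rw [braidLin_tmul ε hM hN hm (N.ract_mem g b n hn), braidLin_tmul ε hM hN hm hn, map_smul,
        tensor_ract, tmul_bal, hM g a m hm, map_smul, smul_smul,
        ε.map_mul_right, ε.antisymm (d g) a]
      congr 1
      push_cast
      field_simp)
  map_deg c := tensor_deg_le _ _ _ (fun a b m n hm hn hc => by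
    rw [braidLin_tmul ε hM hN hm hn]
    exact Submodule.smul_mem _ _ (tmul_mem hn hm (by rw [← hc, mul_comm])))

theorem braid_tmul (ε : ColorFactor k d) {M N : GradedBimod k d} (hM : IsColor ε M)
    (hN : IsColor ε N) {a b : B} {m : M.carrier} {n : N.carrier} (hm : m ∈ M.deg a)
    (hn : n ∈ N.deg b) :
    (braid ε hM hN).toLin (tmul M N m n) = (ε.toFun a b : k) • tmul N M n m :=
  braidLin_tmul ε hM hN hm hn

theorem braid_braid (ε : ColorFactor k d) {M N : GradedBimod k d} (hM : IsColor ε M)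
    (hN : IsColor ε N) : braid ε hM hN ≫ braid ε hN hM = 𝟙 (tensor M N) :=
  hom_ext (braidLin_braidLin ε hM hN)

theorem braid_naturality (ε : ColorFactor k d) {M M' N N' : GradedBimod k d} (hM : IsColor ε M)
    (hM' : IsColor ε M') (hN : IsColor ε N) (hN' : IsColor ε N') (f : M ⟶ M') (g : N ⟶ N') :
    tensorMap f g ≫ braid ε hM' hN' = braid ε hM hN ≫ tensorMap g f :=
  hom_ext (tensor_ext_deg fun a m hm b n hn => by
    simp only [comp_toLin, LinearMap.comp_apply, tensorMap_tmul]
    rw [braid_tmul ε hM' hN' (f.map_deg a m hm) (g.map_deg b n hn), braid_tmul ε hM hN hm hn,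
      map_smul, tensorMap_tmul])

theorem tensor_ext_deg₃ {M N P : GradedBimod k d} {Q : Type*} [AddCommGroup Q] [Module k Q]
    {f g : (tensor (tensor M N) P).carrier →ₗ[k] Q}
    (h : ∀ a, ∀ m ∈ M.deg a, ∀ b, ∀ n ∈ N.deg b, ∀ c, ∀ p ∈ P.deg c,
      f (tmul (tensor M N) P (tmul M N m n) p) =
        g (tmul (tensor M N) P (tmul M N m n) p)) : f = g := by
  have : (tmul (tensor M N) P).compr₂ f = (tmul (tensor M N) P).compr₂ g :=
    tensor_ext_deg fun a m hm b n hn => lin_ext (h a m hm b n hn)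
  exact tensor_ext fun x p => LinearMap.congr_fun₂ this x p

theorem tensor_ext_deg₃' {M N P : GradedBimod k d} {Q : Type*} [AddCommGroup Q] [Module k Q]
    {f g : (tensor M (tensor N P)).carrier →ₗ[k] Q}
    (h : ∀ a, ∀ m ∈ M.deg a, ∀ b, ∀ n ∈ N.deg b, ∀ c, ∀ p ∈ P.deg c,
      f (tmul M (tensor N P) m (tmul N P n p)) =
        g (tmul M (tensor N P) m (tmul N P n p))) : f = g := by
  have : (tmul M (tensor N P)).compr₂ f = (tmul M (tensor N P)).compr₂ g :=
    lin_ext fun a m hm => tensor_ext_deg (h a m hm)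
  exact tensor_ext fun x p => LinearMap.congr_fun₂ this x p

theorem braid_hexagon (ε : ColorFactor k d) {X Y Z : GradedBimod k d} (hX : IsColor ε X)
    (hY : IsColor ε Y) (hZ : IsColor ε Z) :
    (assoc X Y Z).hom ≫ braid ε hX (isColor_tensor ε Y Z hY hZ) ≫ (assoc Y Z X).hom =
      tensorMap (braid ε hX hY) (𝟙 Z) ≫ (assoc Y X Z).hom ≫
        tensorMap (𝟙 Y) (braid ε hX hZ) :=
  hom_ext (tensor_ext_deg₃ fun a x hx b y hy c z hz => by
    simp only [comp_toLin, LinearMap.comp_apply, tensorMap_tmul, assoc, assocLin_tmul]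
    rw [braid_tmul ε hX _ hx (tmul_mem hy hz rfl), braid_tmul ε hX hY hx hy]
    simp only [map_smul, assocLin_tmul, LinearMap.smul_apply, tensorMap_tmul, id_toLin,
      LinearMap.id_apply]
    rw [braid_tmul ε hX hZ hx hz]
    simp [smul_smul, ε.map_mul_right])

theorem braid_hexagon' (ε : ColorFactor k d) {X Y Z : GradedBimod k d} (hX : IsColor ε X)
    (hY : IsColor ε Y) (hZ : IsColor ε Z) :
    (assoc X Y Z).inv ≫ braid ε (isColor_tensor ε X Y hX hY) hZ ≫ (assoc Z X Y).inv =
      tensorMap (𝟙 X) (braid ε hY hZ) ≫ (assoc X Z Y).inv ≫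
        tensorMap (braid ε hX hZ) (𝟙 Y) :=
  hom_ext (tensor_ext_deg₃' fun a x hx b y hy c z hz => by
    simp only [comp_toLin, LinearMap.comp_apply, tensorMap_tmul, assoc, assocInvLin_tmul]
    rw [braid_tmul ε _ hZ (tmul_mem hx hy rfl) hz, braid_tmul ε hY hZ hy hz]
    simp only [map_smul, assocInvLin_tmul, tensorMap_tmul, id_toLin, LinearMap.id_apply]
    rw [braid_tmul ε hX hZ hx hz]
    simp [smul_smul, ε.map_mul_left, mul_comm])

/-- The full subcategory of color bimodules, with the monoidal structure `⊗_{k[G]}`. -/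
abbrev Color (ε : ColorFactor k d) := (IsColor ε).FullSubcategory

/-- The symmetric braiding `τ(m ⊗ n) = ε(|m|, |n|) n ⊗ m`. -/
instance (ε : ColorFactor k d) : SymmetricCategory (Color ε) where
  braiding X Y := (IsColor ε).isoMk
    { hom := braid ε X.property Y.property
      inv := braid ε Y.property X.property
      hom_inv_id := braid_braid ε X.property Y.property
      inv_hom_id := braid_braid ε Y.property X.property }
  braiding_naturality_right X Y Z f := ObjectProperty.hom_ext _
    (braid_naturality ε X.property X.property Y.property Z.property (𝟙 X.obj) f.hom)
  braiding_naturality_left {X Y} f Z := ObjectProperty.hom_ext _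
    (braid_naturality ε X.property Y.property Z.property Z.property f.hom (𝟙 Z.obj))
  hexagon_forward X Y Z := ObjectProperty.hom_ext _
    (braid_hexagon ε X.property Y.property Z.property)
  hexagon_reverse X Y Z := ObjectProperty.hom_ext _
    (braid_hexagon' ε X.property Y.property Z.property)
  symmetry X Y := ObjectProperty.hom_ext _ (braid_braid ε X.property Y.property)

end GradedBimod

/-! ### Quantum Drinfeld orbifold algebras -/

/-- The data defining `H_{q,κ}`: an action of `G` on `V`, diagonal in the basis `v` with
characters `χ i`, a quantum system of parameters `q`, and a parameter function `κ`. -/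
structure DrinfeldDatum (k V G : Type u) [Field k] [AddCommGroup V] [Module k V] [CommGroup G]
    (n : ℕ) where
  v : Module.Basis (Fin n) k V
  ρ : Representation k G V
  χ : Fin n → G →* kˣ
  diag : ∀ g i, ρ g (v i) = (χ i g : k) • v i
  q : Fin n → Fin n → kˣ
  q_self : ∀ i, q i i = 1
  q_symm : ∀ i j, q j i = (q i j)⁻¹
  κ : V →ₗ[k] V →ₗ[k] V ⊗[k] MonoidAlgebra k G
  κ_antisymm : ∀ i j, κ (v i) (v j) = -((q i j : k) • κ (v j) (v i))

namespace DrinfeldDatum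

variable {k V G : Type u} [Field k] [AddCommGroup V] [Module k V] [CommGroup G] {n : ℕ}
  (D : DrinfeldDatum k V G n)

/-- The coefficient of `v r ⊗ g` in `κ (v i) (v j)`. -/
def coeff (i j r : Fin n) (g : G) : k :=
  (D.v.tensorProduct (MonoidAlgebra.basis G k)).repr (D.κ (D.v i) (D.v j)) (r, g)

/-- The tensor algebra `T(V)`, with the action of `G` extending the one on `V`. -/
def TV (_ : DrinfeldDatum k V G n) : Type u := TensorAlgebra k V

instance : Ring D.TV := inferInstanceAs (Ring (TensorAlgebra k V))

instance : Algebra k D.TV := inferInstanceAs (Algebra k (TensorAlgebra k V))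

/-- The inclusion `V → T(V)`. -/
def ι : V →ₗ[k] D.TV := TensorAlgebra.ι k

/-- The automorphism of `T(V)` extending the action of `g` on `V`. -/
def act (g : G) : D.TV →ₐ[k] D.TV := TensorAlgebra.lift k (D.ι ∘ₗ D.ρ g)

@[simp]
theorem act_ι (g : G) (w : V) : D.act g (D.ι w) = D.ι (D.ρ g w) :=
  TensorAlgebra.lift_ι_apply (D.ι ∘ₗ D.ρ g) w

theorem algHom_ext {A : Type*} [Semiring A] [Algebra k A] {f g : D.TV →ₐ[k] A}
    (h : ∀ w, f (D.ι w) = g (D.ι w)) : f = g :=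
  TensorAlgebra.hom_ext (LinearMap.ext h)

theorem act_one : D.act 1 = AlgHom.id k D.TV := D.algHom_ext fun w => by simp

theorem act_mul (g h : G) : D.act (g * h) = (D.act g).comp (D.act h) :=
  D.algHom_ext fun w => by simp

instance : MulSemiringAction G D.TV where
  smul g x := D.act g x
  one_smul x := DFunLike.congr_fun D.act_one x
  mul_smul g h x := DFunLike.congr_fun (D.act_mul g h) x
  smul_zero g := map_zero (D.act g)
  smul_add g := map_add (D.act g)
  smul_one g := map_one (D.act g)
  smul_mul g := map_mul (D.act g)

theorem smul_eq_act (g : G) (x : D.TV) : g • x = D.act g x := rfl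

instance : SMulCommClass G k D.TV where
  smul_comm g c x := map_smul (D.act g) c x

/-- The skew group algebra `T(V) ⋊ G`. -/
abbrev Skew : Type u := SkewMonoidAlgebra D.TV G

/-- The inclusion `V → T(V) ⋊ G`. -/
def skewV : V →ₗ[k] D.Skew := SkewMonoidAlgebra.lsingle k (1 : G) ∘ₗ D.ι

/-- The inclusion `G → T(V) ⋊ G`. -/
def skewG : G →* D.Skew := SkewMonoidAlgebra.of D.TV G

/-- The map `V ⊗ k[G] → T(V) ⋊ G`, `w ⊗ g ↦ w g`. -/
def skewVG : V ⊗[k] MonoidAlgebra k G →ₗ[k] D.Skew :=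
  TensorProduct.lift ((LinearMap.mul k D.Skew).compl₁₂ D.skewV
    (MonoidAlgebra.lift k D.Skew G D.skewG).toLinearMap)

/-- The defining relations `v_i v_j - q_{ij} v_j v_i = κ(v_i, v_j)`. -/
inductive Rel : D.Skew → D.Skew → Prop
  | comm (i j : Fin n) :
    Rel (D.skewV (D.v i) * D.skewV (D.v j) - (D.q i j : k) • (D.skewV (D.v j) * D.skewV (D.v i)))
      (D.skewVG (D.κ (D.v i) (D.v j)))

/-- The algebra `H_{q,κ}`: the quotient of `T(V) ⋊ G` by the defining relations. -/
def H : Type u := RingQuot D.Rel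

instance : Ring D.H := inferInstanceAs (Ring (RingQuot D.Rel))

instance : Algebra k D.H := inferInstanceAs (Algebra k (RingQuot D.Rel))

/-- The quotient map `T(V) ⋊ G → H_{q,κ}`. -/
def proj : D.Skew →ₐ[k] D.H := RingQuot.mkAlgHom k D.Rel

/-- The image of the basis vector `v i` in `H_{q,κ}`. -/
def x (i : Fin n) : D.H := D.proj (D.skewV (D.v i))

/-- The image of the group element `g` in `H_{q,κ}`. -/
def γ : G →* D.H := (D.proj : D.Skew →* D.H).comp D.skewG

/-- The monomial `v_1^{m_1} ⋯ v_n^{m_n} g` in `H_{q,κ}`. -/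
def monomial (p : (Fin n → ℕ) × G) : D.H :=
  (List.ofFn fun i => D.x i ^ p.1 i).prod * D.γ p.2

/-- `H_{q,κ}` is a quantum Drinfeld orbifold algebra: it has the PBW property, that is, the
monomials `v_1^{m_1} ⋯ v_n^{m_n} g` are a basis. -/
def IsQuantumDrinfeldOrbifoldAlgebra : Prop :=
  LinearIndependent k D.monomial ∧ Submodule.span k (Set.range D.monomial) = ⊤

/-- The strong vanishing condition. -/
def StrongVanishing : Prop :=
  ∀ (g : G) (i j l r : Fin n), D.coeff i j r g ≠ 0 →
    D.ρ g (D.v l) = ((D.q i l * D.q j l * D.q l r : kˣ) : k) • D.v l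

/-! ### The grading by `A/N` -/

/-- The group `A = ℤⁿ × G`. -/
abbrev A (_ : DrinfeldDatum k V G n) : Type u := Multiplicative (Fin n → ℤ) × G

/-- The degree of `v i` in `A`. -/
def degV (i : Fin n) : D.A := (Multiplicative.ofAdd (Pi.single i 1), 1)

/-- The degree of `g` in `A`. -/
def degG (g : G) : D.A := (1, g)

/-- The subgroup generated by the `|v_i| |v_j| |v_r|⁻¹ |g|⁻¹` for which `v_r ⊗ g` occurs in
`κ(v_i, v_j)`. -/
def N : Subgroup D.A :=
  Subgroup.closure {a | ∃ i j r g, D.coeff i j r g ≠ 0 ∧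
    a = D.degV i * D.degV j * (D.degV r)⁻¹ * (D.degG g)⁻¹}

/-- The grading of `G` by `A/N`. -/
def groupDegree : G →* D.A ⧸ D.N :=
  (QuotientGroup.mk' D.N).comp (MonoidHom.inr (Multiplicative (Fin n → ℤ)) G)

/-- The degree of `v_i ⊗ g` in `A/N`. -/
def degVG (i : Fin n) (g : G) : D.A ⧸ D.N := QuotientGroup.mk (D.degV i * D.degG g)

/-- The component of `H_{q,κ}` of degree `b`, spanned by the words `v_{i_1} ⋯ v_{i_m} g` with
`|v_{i_1}| ⋯ |v_{i_m}| |g| = b` in `A/N`. -/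
def deg (b : D.A ⧸ D.N) : Submodule k D.H :=
  Submodule.span k {y | ∃ (w : List (Fin n)) (g : G),
    QuotientGroup.mk ((w.map D.degV).prod * D.degG g) = b ∧ y = (w.map D.x).prod * D.γ g}

/-- `H_{q,κ}` is the direct sum of its components. -/
def IsGraded : Prop := iSupIndep D.deg ∧ iSup D.deg = ⊤

theorem γ_mul_x (g : G) (i : Fin n) : D.γ g * D.x i = (D.χ i g : k) • (D.x i * D.γ g) := by
  have : D.skewG g * D.skewV (D.v i) = (D.χ i g : k) • (D.skewV (D.v i) * D.skewG g) := by
    simp only [skewG, skewV, SkewMonoidAlgebra.of_apply, LinearMap.comp_apply,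
      SkewMonoidAlgebra.lsingle_apply, SkewMonoidAlgebra.single_mul_single, one_mul, mul_one,
      one_smul, smul_eq_act, act_ι, D.diag, map_smul, SkewMonoidAlgebra.smul_single]
  have h := congrArg D.proj this
  rwa [map_mul, map_smul, map_mul] at h

theorem γ_mul_word (g : G) (w : List (Fin n)) : D.γ g * (w.map D.x).prod =
    ((w.map fun i => D.χ i g).prod : kˣ) • ((w.map D.x).prod * D.γ g) := by
  induction w with
  | nil => simp
  | cons i w ih =>
    simp only [List.map_cons, List.prod_cons]
    rw [← mul_assoc, γ_mul_x, smul_mul_assoc, mul_assoc, ih, mul_smul_comm, mul_assoc, mul_smul]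
    rfl

theorem lact_mem (g : G) (b : D.A ⧸ D.N) (m : D.H) (hm : m ∈ D.deg b) :
    D.γ g * m ∈ D.deg (D.groupDegree g * b) := by
  induction hm using Submodule.span_induction with
  | mem y hy =>
    obtain ⟨w, h, rfl, rfl⟩ := hy
    rw [← mul_assoc, γ_mul_word, smul_mul_assoc, mul_assoc, ← map_mul]
    refine Submodule.smul_mem _ (((w.map fun i => D.χ i g).prod : kˣ) : k)
      (Submodule.subset_span ⟨w, g * h, ?_, rfl⟩)
    have : (w.map D.degV).prod * D.degG (g * h) = D.degG g * ((w.map D.degV).prod * D.degG h) := by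
      have : D.degG (g * h) = D.degG g * D.degG h := by simp [degG]
      rw [this, mul_left_comm]
    rw [this]
    rfl
  | zero => rw [mul_zero]; exact zero_mem _
  | add y z _ _ hy hz => rw [mul_add]; exact add_mem hy hz
  | smul c y _ hy => rw [mul_smul_comm]; exact Submodule.smul_mem _ _ hy

theorem ract_mem (g : G) (b : D.A ⧸ D.N) (m : D.H) (hm : m ∈ D.deg b) :
    m * D.γ g ∈ D.deg (b * D.groupDegree g) := by
  induction hm using Submodule.span_induction with
  | mem y hy =>
    obtain ⟨w, h, rfl, rfl⟩ := hy
    rw [mul_assoc, ← map_mul]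
    refine Submodule.subset_span ⟨w, h * g, ?_, rfl⟩
    have : (w.map D.degV).prod * D.degG (h * g) = (w.map D.degV).prod * D.degG h * D.degG g := by
      have : D.degG (h * g) = D.degG h * D.degG g := by simp [degG]
      rw [this, mul_assoc]
    rw [this]
    rfl
  | zero => rw [zero_mul]; exact zero_mem _
  | add y z _ _ hy hz => rw [add_mul]; exact add_mem hy hz
  | smul c y _ hy => rw [smul_mul_assoc]; exact Submodule.smul_mem _ _ hy

/-- `H_{q,κ}` as an `A/N`-graded `k[G]`-bimodule, `G` acting by left and right multiplication. -/
def bimod (h : D.IsGraded) : GradedBimod k D.groupDegree where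
  carrier := D.H
  lact g := LinearMap.mulLeft k (D.γ g)
  ract g := LinearMap.mulRight k (D.γ g)
  lact_one m := by simp
  lact_mul g h m := by simp [mul_assoc]
  ract_one m := by simp
  ract_mul g h m := by simp [mul_assoc]
  lact_ract g h m := by simp [mul_assoc]
  deg := D.deg
  deg_indep := h.1
  deg_iSup := h.2
  lact_mem := D.lact_mem
  ract_mem := D.ract_mem

/-- The identity map from `H_{q,κ}` to the space underlying the bimodule `D.bimod h`. -/
def toBimod (h : D.IsGraded) : D.H ≃ₗ[k] (D.bimod h).carrier := LinearEquiv.refl k D.H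

end DrinfeldDatum

end

/-! The algebra H is given by generators and relations. An algebra map out of it is therefore a
choice of elements `y i` and a homomorphism `u` from G with `u g * y i = χ_i(g) • (y i * u g)` that
satisfy the q-commutation relations (`liftH`). The grading, Δ, the counit and S are all obtained by
checking these conditions in a suitable target.

Bicharacter. On A = ℤⁿ × G set ε(|v_i|,|v_j|) = q_ij, ε(|g|,|v_j|) = χ_j(g), ε(|g|,|h|) = 1. It
descends to A/N exactly when N lies in its radical (`N_le_ker_bicharHom`). A generator of N coming
from v_r ⊗ g in κ(v_i,v_j) pairs with |v_l| to q_il q_jl q_rl⁻¹ χ_l(g)⁻¹, which is 1 by strong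
vanishing. It pairs with h in G to χ_r(h) χ_i(h)⁻¹ χ_j(h)⁻¹, which is 1 because κ is G-invariant.
Invariance is forced by PBW (`χ_eq_of_coeff_ne_zero`): conjugate the defining relation by h and
compare coefficients in the independent family x_r g.

Grading. Modulo N the defining relations are homogeneous, so H carries a coaction of the group
algebra of A/N, and this separates the components (`isGraded`).

Hopf structure. In H ⊗ H the braiding gives (1 ⊗ x_i)(x_j ⊗ 1) = q_ij x_j ⊗ x_i. The mixed terms
then cancel in the q-commutator of the primitive elements x_i ⊗ 1 + 1 ⊗ x_i, which leaves κ ⊗ 1 + 1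
⊗ κ (`comulGen_rel`). This matches the image of κ, since elements of G pass across ⊗ over k[G]
(`mapVG_comulGen`). The map x_i ↦ -x_i respects the relations in the braided opposite algebra
(`antipodeGen_rel`). The coalgebra axioms compare algebra maps, so they are checked on generators.
The antipode axioms do not; there a single letter at the end of a word already kills the convolution
(`antipode_left_mul_x`, `antipode_right_mul_x`). -/

noncomputable section

namespace DrinfeldDatum

variable {k V G : Type u} [Field k] [AddCommGroup V] [Module k V] [CommGroup G] {n : ℕ}
  (D : DrinfeldDatum k V G n)

/-! ### The universal property of `H_{q,κ}` -/

/-- The basis `v r ⊗ g` of `V ⊗ k[G]`. -/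
def basisVG : Module.Basis (Fin n × G) k (V ⊗[k] MonoidAlgebra k G) :=
  D.v.tensorProduct (MonoidAlgebra.basis G k)

theorem basisVG_apply (r : Fin n) (g : G) :
    D.basisVG (r, g) = D.v r ⊗ₜ MonoidAlgebra.single g 1 := by
  simp [basisVG, Module.Basis.tensorProduct_apply]

/-- Two linear maps agree on `κ (v i) (v j)` if they do on all `v r ⊗ g` that occur in it. -/
theorem map_κ_congr {P : Type*} [AddCommGroup P] [Module k P]
    (f f' : V ⊗[k] MonoidAlgebra k G →ₗ[k] P) (i j : Fin n)
    (h : ∀ r g, D.coeff i j r g ≠ 0 → f (D.basisVG (r, g)) = f' (D.basisVG (r, g))) :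
    f (D.κ (D.v i) (D.v j)) = f' (D.κ (D.v i) (D.v j)) := by
  rw [← D.basisVG.linearCombination_repr (D.κ (D.v i) (D.v j))]
  simp only [Finsupp.linearCombination_apply, Finsupp.sum, map_sum, map_smul]
  refine Finset.sum_congr rfl fun p hp => ?_
  rw [h p.1 p.2 (Finsupp.mem_support_iff.1 hp)]

/-- The linear map `v r ⊗ g ↦ y r * u g`. -/
def mapVG {R : Type*} [Ring R] [Algebra k R] (y : Fin n → R) (u : G →* R) :
    V ⊗[k] MonoidAlgebra k G →ₗ[k] R :=
  TensorProduct.lift ((LinearMap.mul k R).compl₁₂ (D.v.constr k y)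
    (MonoidAlgebra.lift k R G u).toLinearMap)

@[simp]
theorem mapVG_basisVG {R : Type*} [Ring R] [Algebra k R] (y : Fin n → R) (u : G →* R)
    (r : Fin n) (g : G) : D.mapVG y u (D.basisVG (r, g)) = y r * u g := by
  rw [basisVG_apply, mapVG, TensorProduct.lift.tmul]
  simp [D.v.constr_basis]

theorem proj_skewVG (t : V ⊗[k] MonoidAlgebra k G) :
    D.proj (D.skewVG t) = D.mapVG D.x D.γ t := by
  have : D.proj.toLinearMap ∘ₗ D.skewVG = D.mapVG D.x D.γ := D.basisVG.ext fun ⟨r, g⟩ => by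
    rw [mapVG_basisVG, LinearMap.comp_apply, basisVG_apply, skewVG, TensorProduct.lift.tmul]
    simp [x, γ]
  exact LinearMap.congr_fun this t

/-- Puts the defining relation in the shape of the hypothesis `hrel` of `liftH`, so that relations
in H and in a target algebra can be compared through `mapVG`. -/
theorem x_mul_x_sub (i j : Fin n) : D.x i * D.x j - (D.q i j : k) • (D.x j * D.x i) =
    D.mapVG D.x D.γ (D.κ (D.v i) (D.v j)) := by
  rw [← proj_skewVG]
  have : D.proj _ = D.proj _ := RingQuot.mkAlgHom_rel k (Rel.comm (D := D) i j)
  simpa [x] using this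

section lift

variable {R : Type*} [Ring R] [Algebra k R] (y : Fin n → R) (u : G →* R)
  (hu : ∀ g i, u g * y i = (D.χ i g : k) • (y i * u g))
  (hrel : ∀ i j, y i * y j - (D.q i j : k) • (y j * y i) = D.mapVG y u (D.κ (D.v i) (D.v j)))

/-- The algebra morphism `T(V) → R` with `v i ↦ y i`. -/
def liftTV : D.TV →ₐ[k] R := TensorAlgebra.lift k (D.v.constr k y)

@[simp]
theorem liftTV_ι (w : V) : D.liftTV y (D.ι w) = D.v.constr k y w :=
  TensorAlgebra.lift_ι_apply (D.v.constr k y) w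

-- The compatibility needed to extend from T(V) to the skew group algebra. It passes to sums and
-- products in `t`, so the commutation rule `hu` on generators suffices.
include hu in
theorem liftTV_act (g : G) (t : D.TV) : D.liftTV y (D.act g t) * u g = u g * D.liftTV y t := by
  induction t using TensorAlgebra.induction with
  | algebraMap r =>
    have h : D.act g (algebraMap k D.TV r) = algebraMap k D.TV r := (D.act g).commutes r
    have h' : D.liftTV y (algebraMap k D.TV r) = algebraMap k R r := (D.liftTV y).commutes r
    exact (congrArg (fun z => D.liftTV y z * u g) h).trans
      ((congrArg (· * u g) h').trans ((Algebra.commutes r (u g)).trans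
        (congrArg (u g * ·) h').symm))
  | ι w =>
    have h : (LinearMap.mulRight k (u g)) ∘ₗ (D.v.constr k y) ∘ₗ D.ρ g =
        (LinearMap.mulLeft k (u g)) ∘ₗ (D.v.constr k y) := D.v.ext fun i => by
      simp [D.diag, D.v.constr_basis, hu]
    have h' := LinearMap.congr_fun h w
    have e1 : D.liftTV y (D.act g (D.ι w)) * u g = u g * D.liftTV y (D.ι w) := by
      rw [act_ι, liftTV_ι, liftTV_ι]
      exact h'
    exact e1
  | mul a b ha hb =>
    have e : D.liftTV y (D.act g ((show D.TV from a) * (show D.TV from b))) * u g =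
        u g * D.liftTV y ((show D.TV from a) * (show D.TV from b)) := by
      rw [map_mul, map_mul, map_mul, mul_assoc, hb, ← mul_assoc, ha, mul_assoc]
    exact e
  | add a b ha hb =>
    have e : D.liftTV y (D.act g ((show D.TV from a) + (show D.TV from b))) * u g =
        u g * D.liftTV y ((show D.TV from a) + (show D.TV from b)) := by
      rw [map_add, map_add, map_add, mul_add, add_mul, hb, ha]
    exact e

/-- The algebra morphism `T(V) ⋊ G → R` with `v i ↦ y i` and `g ↦ u g`. -/
def liftSkew : D.Skew →ₐ[k] R :=
  SkewMonoidAlgebra.liftNCAlgHom (D.liftTV y) u fun {t g} => D.liftTV_act y u hu g t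

theorem liftSkew_single (g : G) (t : D.TV) :
    D.liftSkew y u hu (SkewMonoidAlgebra.single g t) = D.liftTV y t * u g :=
  SkewMonoidAlgebra.liftNC_single _ _ _ _

@[simp]
theorem liftSkew_skewV (i : Fin n) : D.liftSkew y u hu (D.skewV (D.v i)) = y i := by
  have := D.liftSkew_single y u hu 1 (D.ι (D.v i))
  rw [liftTV_ι, D.v.constr_basis, map_one, mul_one] at this
  exact this

@[simp]
theorem liftSkew_skewG (g : G) : D.liftSkew y u hu (D.skewG g) = u g := by
  have := D.liftSkew_single y u hu g 1
  rw [map_one, one_mul] at this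
  exact this

theorem liftSkew_skewVG (t : V ⊗[k] MonoidAlgebra k G) :
    D.liftSkew y u hu (D.skewVG t) = D.mapVG y u t := by
  have : (D.liftSkew y u hu).toLinearMap ∘ₗ D.skewVG = D.mapVG y u :=
    D.basisVG.ext fun ⟨r, g⟩ => by
      rw [mapVG_basisVG, LinearMap.comp_apply, basisVG_apply, skewVG, TensorProduct.lift.tmul]
      simp
  exact LinearMap.congr_fun this t

/-- The algebra morphism `H_{q,κ} → R` with `x i ↦ y i` and `g ↦ u g`. -/
def liftH : D.H →ₐ[k] R :=
  RingQuot.liftAlgHom k ⟨D.liftSkew y u hu, by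
    rintro _ _ ⟨i, j⟩
    rw [liftSkew_skewVG, ← hrel]
    simp⟩

theorem liftH_proj (a : D.Skew) : D.liftH y u hu hrel (D.proj a) = D.liftSkew y u hu a :=
  RingQuot.liftAlgHom_mkAlgHom_apply _ _ _ _

@[simp]
theorem liftH_x (i : Fin n) : D.liftH y u hu hrel (D.x i) = y i := by
  rw [x, liftH_proj, liftSkew_skewV]

@[simp]
theorem liftH_γ (g : G) : D.liftH y u hu hrel (D.γ g) = u g :=
  (D.liftH_proj y u hu hrel _).trans (D.liftSkew_skewG y u hu g)

end lift

end DrinfeldDatum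

namespace DrinfeldDatum

variable {k V G : Type u} [Field k] [AddCommGroup V] [Module k V] [CommGroup G] {n : ℕ}
  (D : DrinfeldDatum k V G n)

/-! ### Invariance of `κ` -/

/-- Identifies the PBW monomial whose exponent vector is a unit vector. The induction is on the
number of factors and splits off the first one, so it must run over arbitrary families `y`. -/
theorem ofFn_pow_single_prod (r : Fin n) :
    (List.ofFn fun i => D.x i ^ (Pi.single r 1 : Fin n → ℕ) i).prod = D.x r := by
  have key : ∀ (m : ℕ) (y : Fin m → D.H) (r : Fin m),
      (List.ofFn fun i => y i ^ (Pi.single r 1 : Fin m → ℕ) i).prod = y r := by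
    intro m
    induction m with
    | zero => exact fun _ r => r.elim0
    | succ m ih =>
      intro y r
      rw [List.ofFn_succ, List.prod_cons]
      induction r using Fin.cases with
      | zero =>
        have h : (List.ofFn fun i : Fin m =>
            y i.succ ^ (Pi.single 0 1 : Fin (m + 1) → ℕ) i.succ).prod = 1 := by
          apply List.prod_eq_one
          simp
        rw [h]
        simp
      | succ r =>
        have h := ih (fun i => y i.succ) r
        have e : ∀ i : Fin m, (Pi.single r.succ 1 : Fin (m + 1) → ℕ) i.succ =
            (Pi.single r 1 : Fin m → ℕ) i := by
          intro i
          simp [Pi.single_apply]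
        simp only [e]
        rw [h]
        simp
  exact key n D.x r

/-- These are the PBW monomials with unit exponent vectors, a subfamily of an independent family. -/
theorem linearIndependent_x_mul_γ (h : LinearIndependent k D.monomial) :
    LinearIndependent k fun p : Fin n × G => D.x p.1 * D.γ p.2 := by
  have e : (fun p : Fin n × G => D.x p.1 * D.γ p.2) =
      D.monomial ∘ fun p : Fin n × G => ((Pi.single p.1 1 : Fin n → ℕ), p.2) := by
    funext p
    simp only [Function.comp_apply, monomial]
    rw [D.ofFn_pow_single_prod]
  rw [e]
  refine h.comp _ fun p p' hp => ?_
  simp only [Prod.mk.injEq] at hp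
  refine Prod.ext ?_ hp.2
  by_contra hne
  have := congrFun hp.1 p.1
  simp [hne] at this

/-- Allows an identity between images of κ in H to be read off in V ⊗ k[G]. -/
theorem mapVG_injective (h : LinearIndependent k D.monomial) :
    Function.Injective (D.mapVG D.x D.γ) := by
  rw [injective_iff_map_eq_zero]
  intro t ht
  have hl := (linearIndependent_iff.1 (D.linearIndependent_x_mul_γ h)) (D.basisVG.repr t) (by
    rw [← ht]
    conv_rhs => rw [← D.basisVG.linearCombination_repr t]
    simp only [Finsupp.linearCombination_apply, Finsupp.sum, map_sum, map_smul]
    exact Finset.sum_congr rfl fun p _ => by rw [mapVG_basisVG])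
  simpa using hl

/-- The PBW property forces `κ` to be `G`-invariant. -/
theorem χ_eq_of_coeff_ne_zero (h : LinearIndependent k D.monomial) {i j r : Fin n} {g : G}
    (hc : D.coeff i j r g ≠ 0) (a : G) : D.χ r a = D.χ i a * D.χ j a := by
  -- `T` is conjugation by `a`: it scales the factor v_r by χ_r(a) and fixes the factor g, since G
  -- is abelian.
  let T : V ⊗[k] MonoidAlgebra k G →ₗ[k] V ⊗[k] MonoidAlgebra k G :=
    D.basisVG.constr k fun p => (D.χ p.1 a : k) • D.basisVG p
  have hT : ∀ p, T (D.basisVG p) = (D.χ p.1 a : k) • D.basisVG p :=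
    fun p => D.basisVG.constr_basis k _ p
  have hγ : ∀ t, D.γ a * D.mapVG D.x D.γ t = D.mapVG D.x D.γ (T t) * D.γ a := by
    have : LinearMap.mulLeft k (D.γ a) ∘ₗ D.mapVG D.x D.γ =
        LinearMap.mulRight k (D.γ a) ∘ₗ D.mapVG D.x D.γ ∘ₗ T := D.basisVG.ext fun ⟨r, g⟩ => by
      simp only [LinearMap.comp_apply, hT, map_smul, mapVG_basisVG, LinearMap.mulLeft_apply,
        LinearMap.mulRight_apply]
      rw [← mul_assoc, γ_mul_x, smul_mul_assoc, mul_assoc, mul_assoc, ← map_mul, ← map_mul,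
        mul_comm]
    exact LinearMap.congr_fun this
  have hxx : ∀ i j, D.γ a * (D.x i * D.x j) =
      ((D.χ i a * D.χ j a : kˣ) : k) • ((D.x i * D.x j) * D.γ a) := by
    intro i j
    rw [← mul_assoc, γ_mul_x, smul_mul_assoc, mul_assoc, γ_mul_x, mul_smul_comm, smul_smul,
      mul_assoc]
    simp
  -- Both x_i x_j and x_j x_i are scaled by χ_i(a) χ_j(a) under conjugation by `a`, hence so is
  -- their q-commutator.
  have h1 : D.γ a * D.mapVG D.x D.γ (D.κ (D.v i) (D.v j)) =
      ((D.χ i a * D.χ j a : kˣ) : k) • (D.mapVG D.x D.γ (D.κ (D.v i) (D.v j)) * D.γ a) := by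
    rw [← x_mul_x_sub, mul_sub, mul_smul_comm, hxx, hxx, sub_mul, smul_sub, smul_mul_assoc,
      smul_comm, mul_comm (D.χ j a)]
  have h2 : T (D.κ (D.v i) (D.v j)) =
      ((D.χ i a * D.χ j a : kˣ) : k) • D.κ (D.v i) (D.v j) := by
    apply D.mapVG_injective h
    -- Right multiplication by the inverse of `a` removes the common factor `D.γ a`, leaving an
    -- equality between values of the injective map `mapVG`.
    have h3 := congrArg (· * D.γ a⁻¹) ((hγ _).symm.trans h1)
    simpa only [smul_mul_assoc, mul_assoc, ← map_mul, mul_inv_cancel, map_one, mul_one,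
      map_smul] using h3
  -- On the coordinate (r, g) the map `T` multiplies by χ_r(a). Against `h2` this gives the claim,
  -- the nonzero coefficient `hc` being cancelled.
  have h4 : ∀ t, D.basisVG.repr (T t) (r, g) = (D.χ r a : k) * D.basisVG.repr t (r, g) := by
    have : Finsupp.lapply (r, g) ∘ₗ D.basisVG.repr.toLinearMap ∘ₗ T =
        (D.χ r a : k) • (Finsupp.lapply (r, g) ∘ₗ D.basisVG.repr.toLinearMap) :=
      D.basisVG.ext fun p => by
        simp only [LinearMap.comp_apply, hT, map_smul, LinearMap.smul_apply,
          LinearEquiv.coe_coe, Module.Basis.repr_self, Finsupp.lapply_apply]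
        by_cases hp : p = (r, g)
        · subst hp; simp
        · simp [hp]
    exact LinearMap.congr_fun this
  have h5 := h4 (D.κ (D.v i) (D.v j))
  rw [h2, map_smul, Finsupp.smul_apply, smul_eq_mul] at h5
  exact Units.ext (mul_right_cancel₀ hc h5).symm

/-! ### The grading -/

/-- This is what N is made for: modulo N, every term of κ(v_i, v_j) acquires the degree of v_i v_j.
-/
theorem coe_degV_mul_degV {i j r : Fin n} {g : G} (h : D.coeff i j r g ≠ 0) :
    ((D.degV i * D.degV j : D.A) : D.A ⧸ D.N) = (D.degV r * D.degG g : D.A) := by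
  rw [eq_comm, QuotientGroup.eq_iff_div_mem]
  rw [← D.N.inv_mem_iff]
  refine Subgroup.subset_closure ⟨i, j, r, g, h, ?_⟩
  rw [inv_div, div_eq_mul_inv, mul_inv, ← mul_assoc]

theorem coe_degG (g : G) : ((D.degG g : D.A) : D.A ⧸ D.N) = D.groupDegree g := rfl

/-- The coaction of the group algebra of `A/N` on `H_{q,κ}`. -/
def coactionAlgHom : D.H →ₐ[k] MonoidAlgebra D.H (D.A ⧸ D.N) :=
  D.liftH (fun i => MonoidAlgebra.single (D.degV i : D.A ⧸ D.N) (D.x i))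
    { toFun := fun g => MonoidAlgebra.single (D.groupDegree g) (D.γ g)
      map_one' := by rw [map_one, map_one]; rfl
      map_mul' := fun g h => by rw [MonoidAlgebra.single_mul_single, map_mul, map_mul] }
    (fun g i => by
      simp only [MonoidHom.coe_mk, OneHom.coe_mk, MonoidAlgebra.single_mul_single, γ_mul_x,
        MonoidAlgebra.smul_single, mul_comm])
    (fun i j => by
      -- Each x_r g occurring in κ(v_i, v_j) sits in degree |v_r||g|, which equals |v_i||v_j| in
      -- A/N. The whole right side is thus concentrated in the degree of the left side.
      have h := D.map_κ_congr
        (MonoidAlgebra.lsingle (R := k) ((D.degV i * D.degV j : D.A) : D.A ⧸ D.N) ∘ₗ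
          D.mapVG D.x D.γ)
        (D.mapVG (fun i => MonoidAlgebra.single (D.degV i : D.A ⧸ D.N) (D.x i))
          { toFun := fun g => MonoidAlgebra.single (D.groupDegree g) (D.γ g)
            map_one' := by rw [map_one, map_one]; rfl
            map_mul' := fun g h => by
              rw [MonoidAlgebra.single_mul_single, map_mul, map_mul] }) i j (fun r g hc => by
          rw [mapVG_basisVG, LinearMap.comp_apply, mapVG_basisVG, D.coe_degV_mul_degV hc]
          simp only [MonoidHom.coe_mk, OneHom.coe_mk, MonoidAlgebra.single_mul_single]
          rfl)
      rw [← h, LinearMap.comp_apply, ← x_mul_x_sub, map_sub, map_smul]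
      simp only [MonoidAlgebra.single_mul_single, mul_comm (D.degV j : D.A ⧸ D.N)]
      rfl)

@[simp]
theorem coactionAlgHom_x (i : Fin n) :
    D.coactionAlgHom (D.x i) = MonoidAlgebra.single (D.degV i : D.A ⧸ D.N) (D.x i) :=
  D.liftH_x _ _ _ _ i

@[simp]
theorem coactionAlgHom_γ (g : G) :
    D.coactionAlgHom (D.γ g) = MonoidAlgebra.single (D.groupDegree g) (D.γ g) :=
  D.liftH_γ _ _ _ _ g

theorem coactionAlgHom_word (w : List (Fin n)) : D.coactionAlgHom (w.map D.x).prod =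
    MonoidAlgebra.single ((w.map D.degV).prod : D.A ⧸ D.N) (w.map D.x).prod := by
  induction w with
  | nil => rw [List.map_nil, List.prod_nil, map_one]; rfl
  | cons i w ih =>
    simp only [List.map_cons, List.prod_cons, map_mul, ih, coactionAlgHom_x,
      MonoidAlgebra.single_mul_single]
    rfl

/-- The spanning half of the PBW property enters the proof only through this statement. -/
theorem span_words (h : Submodule.span k (Set.range D.monomial) = ⊤) :
    Submodule.span k {y | ∃ (w : List (Fin n)) (g : G), y = (w.map D.x).prod * D.γ g} = ⊤ := by
  rw [eq_top_iff, ← h]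
  refine Submodule.span_mono ?_
  rintro _ ⟨⟨m, g⟩, rfl⟩
  -- The word in which each letter i is repeated m_i times, in increasing order of i.
  refine ⟨(List.ofFn fun i => List.replicate (m i) i).flatten, g, ?_⟩
  rw [monomial]
  congr 1
  rw [List.map_flatten, List.prod_flatten, List.map_map, List.map_ofFn]
  congr 2
  funext i
  simp

/-- The coaction sends an element m of the component b to m placed at b, so components of different
degrees are independent; they span because words do. -/
theorem isGraded (h : Submodule.span k (Set.range D.monomial) = ⊤) : D.IsGraded := by
  constructor
  · refine GradedBimod.indep_of_coaction _
      ((MonoidAlgebra.coeffLinearEquiv k).toLinearMap ∘ₗ D.coactionAlgHom.toLinearMap) ?_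
    intro b m hm
    induction hm using Submodule.span_induction with
    | mem y hy =>
      obtain ⟨w, g, rfl, rfl⟩ := hy
      simp only [LinearMap.comp_apply, AlgHom.toLinearMap_apply, map_mul, coactionAlgHom_word,
        coactionAlgHom_γ, MonoidAlgebra.single_mul_single]
      rfl
    | zero => simp
    | add x y _ _ hx hy => rw [map_add, hx, hy, Finsupp.single_add]
    | smul c x _ hx => rw [map_smul, hx, Finsupp.smul_single]
  · rw [eq_top_iff, ← D.span_words h, Submodule.span_le]
    rintro _ ⟨w, g, rfl⟩
    exact Submodule.mem_iSup_of_mem _ (Submodule.subset_span ⟨w, g, rfl, rfl⟩)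

theorem word_mem (w : List (Fin n)) (g : G) : (w.map D.x).prod * D.γ g ∈
    D.deg (QuotientGroup.mk ((w.map D.degV).prod * D.degG g)) :=
  Submodule.subset_span ⟨w, g, rfl, rfl⟩

theorem γ_mem (g : G) : D.γ g ∈ D.deg (D.groupDegree g) := by
  simpa [coe_degG] using D.word_mem [] g

theorem x_mem (i : Fin n) : D.x i ∈ D.deg (D.degV i) := by
  have h : D.degG 1 = 1 := rfl
  simpa [h] using D.word_mem [i] 1

/-- Moving g past a word costs only a scalar, so a product of two spanning elements w g and w' g' is
a multiple of the spanning element w w' g g'. -/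
theorem mul_mem {a b : D.A ⧸ D.N} {m m' : D.H} (hm : m ∈ D.deg a) (hm' : m' ∈ D.deg b) :
    m * m' ∈ D.deg (a * b) := by
  have hle : D.deg a * D.deg b ≤ D.deg (a * b) := by
    rw [deg, deg, Submodule.span_mul_span, Submodule.span_le]
    rintro _ ⟨_, ⟨w, g, rfl, rfl⟩, _, ⟨w', g', rfl, rfl⟩, rfl⟩
    have e : (w.map D.x).prod * D.γ g * ((w'.map D.x).prod * D.γ g') =
        (((w'.map fun i => D.χ i g).prod : kˣ) : k) •
          (((w ++ w').map D.x).prod * D.γ (g * g')) := by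
      rw [mul_assoc, ← mul_assoc (D.γ g), γ_mul_word, smul_mul_assoc, mul_smul_comm,
        List.map_append, List.prod_append, map_mul]
      simp only [mul_assoc]
      rfl
    change (w.map D.x).prod * D.γ g * ((w'.map D.x).prod * D.γ g') ∈ _
    rw [e]
    have hd : D.degG (g * g') = D.degG g * D.degG g' := by simp [degG]
    have := D.word_mem (w ++ w') (g * g')
    rw [List.map_append, List.prod_append, hd, mul_mul_mul_comm] at this
    exact Submodule.smul_mem _ _ this
  exact hle (Submodule.mul_mem_mul hm hm')

/-! ### The bicharacter -/

/-- The bicharacter on `A` with values `q i j` on `(|v i|, |v j|)`, `χ j g` on `(|g|, |v j|)` and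
`1` on `(|g|, |h|)`. -/
def bichar (a b : D.A) : kˣ :=
  (∏ i, ∏ j, D.q i j ^ (a.1.toAdd i * b.1.toAdd j)) * (∏ j, D.χ j a.2 ^ b.1.toAdd j) *
    (∏ i, D.χ i b.2 ^ a.1.toAdd i)⁻¹

theorem bichar_mul_left (a b c : D.A) : D.bichar (a * b) c = D.bichar a c * D.bichar b c := by
  simp only [bichar, Prod.fst_mul, Prod.snd_mul, toAdd_mul, Pi.add_apply, add_mul, zpow_add,
    Finset.prod_mul_distrib, map_mul, mul_zpow, mul_inv]
  have h : ∀ p p' s s' t t' : kˣ, p * p' * (s * s') * (t * t') = p * s * t * (p' * s' * t') :=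
    fun p p' s s' t t' => by rw [mul_mul_mul_comm p, mul_mul_mul_comm (p * s)]
  exact h _ _ _ _ _ _

theorem bichar_mul_right (a b c : D.A) : D.bichar a (b * c) = D.bichar a b * D.bichar a c := by
  simp only [bichar, Prod.fst_mul, Prod.snd_mul, toAdd_mul, Pi.add_apply, mul_add, zpow_add,
    Finset.prod_mul_distrib, map_mul, mul_zpow, mul_inv]
  have h : ∀ p p' s s' t t' : kˣ, p * p' * (s * s') * (t * t') = p * s * t * (p' * s' * t') :=
    fun p p' s s' t t' => by rw [mul_mul_mul_comm p, mul_mul_mul_comm (p * s)]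
  exact h _ _ _ _ _ _

theorem bichar_antisymm (a b : D.A) : D.bichar b a = (D.bichar a b)⁻¹ := by
  simp only [bichar, mul_inv, inv_inv]
  -- Exchanging the arguments interchanges the two χ-products, one of which is inverted. Only the
  -- q-product remains, where q_ji = q_ij⁻¹ applies.
  rw [Finset.prod_comm, mul_right_comm, mul_assoc, mul_assoc]
  congr 1
  · simp only [← Finset.prod_inv_distrib]
    refine Finset.prod_congr rfl fun i _ => Finset.prod_congr rfl fun j _ => ?_
    rw [D.q_symm, inv_zpow, mul_comm]

theorem bichar_degV_left (i : Fin n) (b : D.A) :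
    D.bichar (D.degV i) b = (∏ j, D.q i j ^ b.1.toAdd j) * (D.χ i b.2)⁻¹ := by
  have h1 : (∏ i', ∏ j, D.q i' j ^ ((Pi.single i 1 : Fin n → ℤ) i' * b.1.toAdd j)) =
      ∏ j, D.q i j ^ b.1.toAdd j := by
    rw [Finset.prod_eq_single i (fun i' _ h => by simp [h]) (by simp)]
    simp
  have h2 : (∏ i', D.χ i' b.2 ^ (Pi.single i 1 : Fin n → ℤ) i') = D.χ i b.2 := by
    rw [Finset.prod_eq_single i (fun i' _ h => by simp [h]) (by simp)]
    simp
  simp only [bichar, degV, toAdd_ofAdd, h1, h2, map_one, one_zpow, Finset.prod_const_one, mul_one]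

theorem bichar_degG_left (g : G) (b : D.A) :
    D.bichar (D.degG g) b = ∏ j, D.χ j g ^ b.1.toAdd j := by
  simp [bichar, degG]

theorem bichar_degV_degV (i j : Fin n) : D.bichar (D.degV i) (D.degV j) = D.q i j := by
  rw [bichar_degV_left, Finset.prod_eq_single j (fun j' _ h => by simp [degV, h]) (by simp)]
  simp [degV]

theorem bichar_degG_degV (g : G) (j : Fin n) : D.bichar (D.degG g) (D.degV j) = D.χ j g := by
  rw [bichar_degG_left, Finset.prod_eq_single j (fun j' _ h => by simp [degV, h]) (by simp)]
  simp [degV]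

theorem bichar_degV_degG (i : Fin n) (g : G) :
    D.bichar (D.degV i) (D.degG g) = (D.χ i g)⁻¹ := by
  rw [bichar_antisymm, bichar_degG_degV]

theorem bichar_degG_degG (g h : G) : D.bichar (D.degG g) (D.degG h) = 1 := by
  rw [bichar_degG_left]
  simp [degG]

/-- The bicharacter as a homomorphism to the group of characters. -/
def bicharHom : D.A →* D.A →* kˣ :=
  MonoidHom.mk' (fun a => MonoidHom.mk' (D.bichar a) (D.bichar_mul_right a))
    fun a b => MonoidHom.ext (D.bichar_mul_left a b)

@[simp]
theorem bicharHom_apply (a b : D.A) : D.bicharHom a b = D.bichar a b := rfl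

/-! ### Descent of the bicharacter to A/N, and the color condition for H. -/

variable (hli : LinearIndependent k D.monomial) (hSV : D.StrongVanishing)

-- Pairing a generator of N with `b` splits into a part in ℤⁿ and a part in G. Strong vanishing
-- trivialises the first, `χ_eq_of_coeff_ne_zero` the second.
include hli hSV in
theorem N_le_ker_bicharHom : D.N ≤ D.bicharHom.ker := by
  rw [N, Subgroup.closure_le]
  rintro _ ⟨i, j, r, g, hc, rfl⟩
  rw [SetLike.mem_coe, MonoidHom.mem_ker]
  ext1 b
  simp only [map_mul, map_inv, MonoidHom.mul_apply, MonoidHom.inv_apply, bicharHom_apply,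
    bichar_degV_left, bichar_degG_left, MonoidHom.one_apply]
  -- The eigenvalue of g on v_l is χ_l(g) by diagonality and q_il q_jl q_lr by strong vanishing.
  have hχ : ∀ l, D.χ l g = D.q i l * D.q j l * (D.q r l)⁻¹ := fun l => by
    have h := hSV g i j l r hc
    rw [D.diag] at h
    have h' := congrArg (fun t => D.v.repr t l) h
    simp only [map_smul, Finsupp.smul_apply, Module.Basis.repr_self, Finsupp.single_eq_same,
      smul_eq_mul, mul_one] at h'
    rw [← D.q_symm]
    exact Units.ext h'
  simp only [hχ, D.χ_eq_of_coeff_ne_zero hli hc b.2, mul_zpow, Finset.prod_mul_distrib, inv_zpow,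
    Finset.prod_inv_distrib]
  generalize (∏ l, D.q i l ^ b.1.toAdd l) = X
  generalize (∏ l, D.q j l ^ b.1.toAdd l) = Y
  generalize (∏ l, D.q r l ^ b.1.toAdd l) = Z
  ext
  push_cast
  field_simp

/-- The bicharacter on `A/N`. -/
def bicharQuot : D.A ⧸ D.N →* D.A ⧸ D.N →* kˣ :=
  QuotientGroup.lift D.N
    (MonoidHom.mk' (fun a => QuotientGroup.lift D.N (D.bicharHom a) fun s hs => by
        -- The second argument must also factor through A/N; antisymmetry turns the left kernel into
        -- a right kernel.
        have : D.bicharHom s = 1 := D.N_le_ker_bicharHom hli hSV hs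
        rw [MonoidHom.mem_ker, bicharHom_apply, bichar_antisymm, ← bicharHom_apply, this,
          MonoidHom.one_apply, inv_one])
      fun a b => by
        ext c
        simp)
    fun s hs => by
      have : D.bicharHom s = 1 := D.N_le_ker_bicharHom hli hSV hs
      ext c
      simp [this]

/-- The bicharacter on `A/N` as a color factor. -/
def colorFactor : ColorFactor k D.groupDegree where
  toFun a b := D.bicharQuot hli hSV a b
  map_mul_right a b c := map_mul _ _ _
  map_mul_left a b c := by rw [map_mul]; rfl
  antisymm a b := by
    induction a using QuotientGroup.induction_on with | H a =>
    induction b using QuotientGroup.induction_on with | H b =>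
    exact D.bichar_antisymm a b
  map_group g h := D.bichar_degG_degG g h

theorem colorFactor_mk (a b : D.A) :
    (D.colorFactor hli hSV).toFun (a : D.A ⧸ D.N) (b : D.A ⧸ D.N) = D.bichar a b := rfl

theorem colorFactor_degVG (i j : Fin n) (g h : G) :
    (D.colorFactor hli hSV).toFun (D.degVG i g) (D.degVG j h) =
      D.q i j * D.χ j g * (D.χ i h)⁻¹ := by
  rw [degVG, degVG, colorFactor_mk, bichar_mul_left, bichar_mul_right, bichar_mul_right,
    bichar_degV_degV, bichar_degV_degG, bichar_degG_degV, bichar_degG_degG, mul_one, mul_right_comm]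

/-- Moving g past a word multiplies it by the product of the χ_i(g) over its letters, which is the
bicharacter of |g| with the degree of the word. The group element ending a word contributes 1, since
G is abelian and ε is trivial on G. -/
theorem isColor_bimod (hgr : D.IsGraded) :
    GradedBimod.IsColor (D.colorFactor hli hSV) (D.bimod hgr) := by
  intro g b m hm
  change D.γ g * (show D.H from m) =
    ((D.colorFactor hli hSV).toFun (D.groupDegree g) b : k) • ((show D.H from m) * D.γ g)
  replace hm : (show D.H from m) ∈ D.deg b := hm
  generalize (show D.H from m) = m' at hm ⊢
  induction hm using Submodule.span_induction with
  | mem y hy =>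
    obtain ⟨w, h, rfl, rfl⟩ := hy
    have e : (D.colorFactor hli hSV).toFun (D.groupDegree g)
        (QuotientGroup.mk ((w.map D.degV).prod * D.degG h)) =
          (w.map fun i => D.χ i g).prod := by
      change D.bicharHom (D.degG g) _ = _
      rw [map_mul, map_list_prod, List.map_map, bicharHom_apply, bichar_degG_degG, mul_one]
      congr 2
      funext i
      exact D.bichar_degG_degV g i
    rw [e, ← mul_assoc, γ_mul_word, smul_mul_assoc, mul_assoc, mul_assoc, ← map_mul, ← map_mul,
      mul_comm g h]
    rfl
  | zero => rw [mul_zero, zero_mul, smul_zero]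
  | add x y _ _ hx hy => rw [mul_add, add_mul, smul_add, hx, hy]
  | smul c x _ hx => rw [mul_smul_comm, smul_mul_assoc, hx, smul_comm]

end DrinfeldDatum

namespace GradedBimod

/-! ### Monoid objects in the category of color bimodules -/

namespace Color

open scoped MonObj

variable {k : Type u} [Field k] {G : Type u} [CommGroup G] {B : Type w} [CommGroup B] {d : G →* B}
  {ε : ColorFactor k d}

/-! ### Structure morphisms of the category evaluated on elements. -/

/-- The linear map underlying a morphism. -/
def ap {X Y : Color ε} (f : X ⟶ Y) : X.obj.carrier →ₗ[k] Y.obj.carrier := f.hom.toLin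

/-- The tensor `x ⊗ y`. -/
def te (X Y : Color ε) : X.obj.carrier →ₗ[k] Y.obj.carrier →ₗ[k] (X ⊗ Y).obj.carrier :=
  tmul X.obj Y.obj

theorem hom_ext' {X Y : Color ε} {f g : X ⟶ Y} (h : ap f = ap g) : f = g :=
  ObjectProperty.hom_ext _ (GradedBimod.hom_ext h)

theorem ap_comp {X Y Z : Color ε} (f : X ⟶ Y) (g : Y ⟶ Z) (x : X.obj.carrier) :
    ap (f ≫ g) x = ap g (ap f x) := rfl

theorem ap_tensorHom {X Y X' Y' : Color ε} (f : X ⟶ X') (g : Y ⟶ Y') (x : X.obj.carrier)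
    (y : Y.obj.carrier) : ap (f ⊗ₘ g) (te X Y x y) = te X' Y' (ap f x) (ap g y) :=
  tensorMap_tmul f.hom g.hom x y

theorem ap_whiskerRight {X X' : Color ε} (f : X ⟶ X') (Y : Color ε) (x : X.obj.carrier)
    (y : Y.obj.carrier) : ap (f ▷ Y) (te X Y x y) = te X' Y (ap f x) y :=
  tensorMap_tmul f.hom (𝟙 Y.obj) x y

theorem ap_whiskerLeft (X : Color ε) {Y Y' : Color ε} (f : Y ⟶ Y') (x : X.obj.carrier)
    (y : Y.obj.carrier) : ap (X ◁ f) (te X Y x y) = te X Y' x (ap f y) :=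
  tensorMap_tmul (𝟙 X.obj) f.hom x y

theorem ap_associator_hom (X Y Z : Color ε) (x : X.obj.carrier) (y : Y.obj.carrier)
    (z : Z.obj.carrier) :
    ap (α_ X Y Z).hom (te (X ⊗ Y) Z (te X Y x y) z) = te X (Y ⊗ Z) x (te Y Z y z) :=
  assocLin_tmul X.obj Y.obj Z.obj x y z

theorem ap_associator_inv (X Y Z : Color ε) (x : X.obj.carrier) (y : Y.obj.carrier)
    (z : Z.obj.carrier) :
    ap (α_ X Y Z).inv (te X (Y ⊗ Z) x (te Y Z y z)) = te (X ⊗ Y) Z (te X Y x y) z :=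
  assocInvLin_tmul X.obj Y.obj Z.obj x y z

/-- The element `g` of the unit object `k[G]`. -/
def one (ε : ColorFactor k d) (g : G) : (𝟙_ (Color ε)).obj.carrier := grp d g

theorem ap_leftUnitor_hom (X : Color ε) (g : G) (x : X.obj.carrier) :
    ap (λ_ X).hom (te (𝟙_ (Color ε)) X (one ε g) x) = X.obj.lact g x :=
  leftUnitorLin_tmul X.obj g x

theorem ap_rightUnitor_hom (X : Color ε) (g : G) (x : X.obj.carrier) :
    ap (ρ_ X).hom (te X (𝟙_ (Color ε)) x (one ε g)) = X.obj.ract g x :=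
  rightUnitorLin_tmul X.obj g x

theorem ap_leftUnitor_inv (X : Color ε) (x : X.obj.carrier) :
    ap (λ_ X).inv x = te (𝟙_ (Color ε)) X (one ε 1) x := rfl

theorem ap_rightUnitor_inv (X : Color ε) (x : X.obj.carrier) :
    ap (ρ_ X).inv x = te X (𝟙_ (Color ε)) x (one ε 1) := rfl

theorem ap_braiding {X Y : Color ε} {a b : B} {x : X.obj.carrier} {y : Y.obj.carrier}
    (hx : x ∈ X.obj.deg a) (hy : y ∈ Y.obj.deg b) :
    ap (β_ X Y).hom (te X Y x y) = (ε.toFun a b : k) • te Y X y x :=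
  braid_tmul ε X.property Y.property hx hy

theorem ap_lact {X Y : Color ε} (f : X ⟶ Y) (g : G) (x : X.obj.carrier) :
    ap f (X.obj.lact g x) = Y.obj.lact g (ap f x) := f.hom.map_lact g x

theorem ap_ract {X Y : Color ε} (f : X ⟶ Y) (g : G) (x : X.obj.carrier) :
    ap f (X.obj.ract g x) = Y.obj.ract g (ap f x) := f.hom.map_ract g x

theorem ap_mem {X Y : Color ε} (f : X ⟶ Y) {b : B} {x : X.obj.carrier} (hx : x ∈ X.obj.deg b) :
    ap f x ∈ Y.obj.deg b := f.hom.map_deg b x hx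

theorem te_mem {X Y : Color ε} {a b c : B} {x : X.obj.carrier} {y : Y.obj.carrier}
    (hx : x ∈ X.obj.deg a) (hy : y ∈ Y.obj.deg b) (h : a * b = c) :
    te X Y x y ∈ (X ⊗ Y).obj.deg c :=
  tmul_mem hx hy h

theorem te_ract {X Y : Color ε} (g : G) (x : X.obj.carrier) (y : Y.obj.carrier) :
    te X Y (X.obj.ract g x) y = te X Y x (Y.obj.lact g y) := tmul_bal g x y

theorem lact_te {X Y : Color ε} (g : G) (x : X.obj.carrier) (y : Y.obj.carrier) :
    (X ⊗ Y).obj.lact g (te X Y x y) = te X Y (X.obj.lact g x) y :=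
  tensor_lact g x y

theorem ract_te {X Y : Color ε} (g : G) (x : X.obj.carrier) (y : Y.obj.carrier) :
    (X ⊗ Y).obj.ract g (te X Y x y) = te X Y x (Y.obj.ract g y) :=
  tensor_ract g x y

theorem lact_one (g h : G) : (𝟙_ (Color ε)).obj.lact g (one ε h) = one ε (g * h) :=
  unit_lact g h

theorem ract_one (g h : G) : (𝟙_ (Color ε)).obj.ract g (one ε h) = one ε (h * g) :=
  unit_ract g h

theorem one_mem (g : G) : one ε g ∈ (𝟙_ (Color ε)).obj.deg (d g) := grp_mem g

theorem te_ext {X Y : Color ε} {P : Type*} [AddCommGroup P] [Module k P]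
    {f g : (X ⊗ Y).obj.carrier →ₗ[k] P}
    (h : ∀ a, ∀ x ∈ X.obj.deg a, ∀ b, ∀ y ∈ Y.obj.deg b, f (te X Y x y) = g (te X Y x y)) :
    f = g :=
  tensor_ext_deg h

theorem te_ext₃ {X Y Z : Color ε} {P : Type*} [AddCommGroup P] [Module k P]
    {f g : ((X ⊗ Y) ⊗ Z).obj.carrier →ₗ[k] P}
    (h : ∀ a, ∀ x ∈ X.obj.deg a, ∀ b, ∀ y ∈ Y.obj.deg b, ∀ c, ∀ z ∈ Z.obj.deg c,
      f (te (X ⊗ Y) Z (te X Y x y) z) = g (te (X ⊗ Y) Z (te X Y x y) z)) :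
    f = g :=
  tensor_ext_deg₃ h

theorem te_one_left_ext {X : Color ε} {P : Type*} [AddCommGroup P] [Module k P]
    {f g : (𝟙_ (Color ε) ⊗ X).obj.carrier →ₗ[k] P}
    (h : ∀ a, ∀ x ∈ X.obj.deg a, f (te _ X (one ε 1) x) = g (te _ X (one ε 1) x)) : f = g := by
  have : f ∘ₗ te _ X (one ε 1) = g ∘ₗ te _ X (one ε 1) := lin_ext h
  exact unit_left_ext fun x => LinearMap.congr_fun this x

theorem te_one_right_ext {X : Color ε} {P : Type*} [AddCommGroup P] [Module k P]
    {f g : (X ⊗ 𝟙_ (Color ε)).obj.carrier →ₗ[k] P}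
    (h : ∀ a, ∀ x ∈ X.obj.deg a, f (te X _ x (one ε 1)) = g (te X _ x (one ε 1))) : f = g := by
  have : f ∘ₗ (te X _).flip (one ε 1) = g ∘ₗ (te X _).flip (one ε 1) := lin_ext h
  exact unit_right_ext fun x => LinearMap.congr_fun this x

theorem one_ext {P : Type*} [AddCommGroup P] [Module k P]
    {f g : (𝟙_ (Color ε)).obj.carrier →ₗ[k] P} (h : ∀ x, f (one ε x) = g (one ε x)) : f = g :=
  unit_ext h

/-- Morphisms out of the unit object are determined by the image of `1`. -/
theorem hom_unit_ext {X : Color ε} {f g : 𝟙_ (Color ε) ⟶ X} (h : ap f (one ε 1) = ap g (one ε 1)) :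
    f = g :=
  hom_ext' (one_ext fun x => by
    have e : one ε x = (𝟙_ (Color ε)).obj.lact x (one ε 1) := by
      rw [lact_one, mul_one]
    rw [e, ap_lact, ap_lact, h])

/-! ### The algebra of elements of a monoid object. -/

section Mon

variable (X : Color ε) [MonObj X]

/-- The `k`-algebra underlying a monoid object. -/
def Elts (X : Color ε) : Type u := X.obj.carrier

instance (X : Color ε) : AddCommGroup (Elts X) := inferInstanceAs (AddCommGroup X.obj.carrier)

instance (X : Color ε) : Module k (Elts X) := inferInstanceAs (Module k X.obj.carrier)

/-- The product of a monoid object. -/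
def mulₗ : X.obj.carrier →ₗ[k] X.obj.carrier →ₗ[k] X.obj.carrier := (te X X).compr₂ (ap μ[X])

/-- The image of `g` in a monoid object. -/
def el (g : G) : X.obj.carrier := ap η[X] (one ε g)

variable {X}

theorem mulₗ_apply (a b : X.obj.carrier) : mulₗ X a b = ap μ[X] (te X X a b) := rfl

/-- The left unit axiom evaluated at g ⊗ a. Together with `mulₗ_el` it shows that the G-actions are
recovered from the product. -/
theorem el_mulₗ (g : G) (a : X.obj.carrier) : mulₗ X (el X g) a = X.obj.lact g a := by
  have := congrArg (fun f => ap f (te _ X (one ε g) a)) (MonObj.one_mul X)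
  simpa only [mulₗ_apply, el, ap_comp, ap_whiskerRight, ap_leftUnitor_hom] using this

theorem mulₗ_el (g : G) (a : X.obj.carrier) : mulₗ X a (el X g) = X.obj.ract g a := by
  have := congrArg (fun f => ap f (te X _ a (one ε g))) (MonObj.mul_one X)
  simpa only [mulₗ_apply, el, ap_comp, ap_whiskerLeft, ap_rightUnitor_hom] using this

theorem mulₗ_assoc (a b c : X.obj.carrier) :
    mulₗ X (mulₗ X a b) c = mulₗ X a (mulₗ X b c) := by
  have := congrArg (fun f => ap f (te (X ⊗ X) X (te X X a b) c)) (MonObj.mul_assoc X)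
  simpa only [mulₗ_apply, ap_comp, ap_whiskerLeft, ap_whiskerRight, ap_associator_hom] using this

theorem mulₗ_mem {a b : B} {x y : X.obj.carrier} (hx : x ∈ X.obj.deg a) (hy : y ∈ X.obj.deg b) :
    mulₗ X x y ∈ X.obj.deg (a * b) :=
  ap_mem μ[X] (te_mem hx hy rfl)

theorem el_mem (g : G) : el X g ∈ X.obj.deg (d g) := ap_mem _ (one_mem g)

theorem el_mul (g h : G) : el X (g * h) = mulₗ X (el X g) (el X h) := by
  rw [el_mulₗ, el, el, ← ap_lact, lact_one]

theorem el_one_mulₗ (a : X.obj.carrier) : mulₗ X (el X 1) a = a := by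
  rw [el_mulₗ, X.obj.lact_one]

theorem mulₗ_el_one (a : X.obj.carrier) : mulₗ X a (el X 1) = a := by
  rw [mulₗ_el, X.obj.ract_one]

/-- Makes a monoid object an ordinary algebra, so that the universal property `liftH` can be applied
with it as target. -/
instance : Ring (Elts X) :=
  { (inferInstance : AddCommGroup (Elts X)) with
    mul := fun a b => mulₗ X a b
    one := el X 1
    mul_assoc := mulₗ_assoc
    one_mul := el_one_mulₗ
    mul_one := mulₗ_el_one
    left_distrib := fun a b c => map_add (mulₗ X a) b c
    right_distrib := fun a b c => LinearMap.map_add₂ (mulₗ X) a b c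
    zero_mul := fun a => LinearMap.map_zero₂ (mulₗ X) a
    mul_zero := fun a => map_zero (mulₗ X a) }

instance : Algebra k (Elts X) :=
  Algebra.ofModule (fun c a b => LinearMap.map_smul₂ (mulₗ X) c a b)
    (fun c a b => map_smul (mulₗ X a) c b)

/-- The map `G → X` given by the unit of a monoid object `X`. -/
def elHom (X : Color ε) [MonObj X] : G →* Elts X where
  toFun := el X
  map_one' := rfl
  map_mul' := el_mul

/-- The homogeneous components of the algebra underlying a monoid object. -/
def eltsDeg (X : Color ε) (b : B) : Submodule k (Elts X) := X.obj.deg b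

theorem elts_mul_mem {a b : B} {x y : Elts X} (hx : x ∈ eltsDeg X a) (hy : y ∈ eltsDeg X b) :
    x * y ∈ eltsDeg X (a * b) :=
  mulₗ_mem hx hy

theorem elHom_mem (g : G) : elHom X g ∈ eltsDeg X (d g) := el_mem g

theorem elts_one_mem : (1 : Elts X) ∈ eltsDeg X 1 := by
  simpa using elHom_mem (X := X) 1

/-- The color condition expressed through the product. It supplies the hypothesis `hu` of `liftH`
for generators of the right degree. -/
theorem elHom_mul_of_mem {b : B} {y : Elts X} (hy : y ∈ eltsDeg X b) (g : G) :
    elHom X g * y = (ε.toFun (d g) b : k) • (y * elHom X g) := by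
  have h : ∀ y ∈ X.obj.deg b, mulₗ X (el X g) y = (ε.toFun (d g) b : k) • mulₗ X y (el X g) :=
    fun y hy => by rw [el_mulₗ, mulₗ_el, X.property g _ _ hy]
  exact h y hy

/-- A product in a tensor product of monoid objects. -/
theorem te_mulₗ_te {X Y : Color ε} [MonObj X] [MonObj Y] {b c : B} {x x' : X.obj.carrier}
    {y y' : Y.obj.carrier} (hy : y ∈ Y.obj.deg b) (hx' : x' ∈ X.obj.deg c) :
    mulₗ (X ⊗ Y) (te X Y x y) (te X Y x' y') =
      (ε.toFun b c : k) • te X Y (mulₗ X x x') (mulₗ Y y y') := by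
  -- The product on X ⊗ Y braids the two middle factors y and x' and then multiplies in X and in Y,
  -- so only y and x' need be homogeneous.
  rw [mulₗ_apply, MonObj.tensorObj.mul_def, tensorμ]
  simp only [ap_comp, ap_associator_hom, ap_whiskerLeft, ap_associator_inv, ap_whiskerRight,
    ap_braiding hy hx', map_smul, LinearMap.smul_apply, ap_tensorHom]
  rfl

theorem el_tensor (X Y : Color ε) [MonObj X] [MonObj Y] (g : G) :
    el (X ⊗ Y) g = te X Y (el X g) (el Y 1) := by
  have e : one ε g = (𝟙_ (Color ε)).obj.lact g (one ε 1) := by rw [lact_one, mul_one]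
  rw [el, el, e, ap_lact, ap_lact, MonObj.tensorObj.one_def]
  simp only [ap_comp, ap_leftUnitor_inv, ap_tensorHom, lact_te]
  rfl

theorem el_unit (g : G) : el (𝟙_ (Color ε)) g = one ε g := rfl

theorem ap_mulₗ {X Y : Color ε} [MonObj X] [MonObj Y] (f : X ⟶ Y) [IsMonHom f]
    (a b : X.obj.carrier) : ap f (mulₗ X a b) = mulₗ Y (ap f a) (ap f b) := by
  have := congrArg (fun f : X ⊗ X ⟶ Y => ap f (te X X a b)) (IsMonHom.mul_hom f)
  simpa only [mulₗ_apply, ap_comp, ap_tensorHom] using this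

theorem ap_el {X Y : Color ε} [MonObj X] [MonObj Y] (f : X ⟶ Y) [IsMonHom f]
    (g : G) : ap f (el X g) = el Y g := by
  have := congrArg (fun f : 𝟙_ (Color ε) ⟶ Y => ap f (one ε g)) (IsMonHom.one_hom f)
  simpa only [el, ap_comp] using this

/-- Preserving 1 is enough for the unit axiom, because morphisms out of k[G] are determined by the
image of 1. -/
theorem isMonHom_of_ap {X Y : Color ε} [MonObj X] [MonObj Y] (f : X ⟶ Y)
    (h1 : ap f (el X 1) = el Y 1)
    (hmul : ∀ a b, ap f (mulₗ X a b) = mulₗ Y (ap f a) (ap f b)) : IsMonHom f where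
  one_hom := hom_unit_ext h1
  mul_hom := hom_ext' (te_ext fun _ x _ _ y _ => by
    simpa only [mulₗ_apply, ap_comp, ap_tensorHom] using hmul x y)

/-- A monoid object given by a bilinear product on elements. -/
@[reducible]
def monObjOfMul (X : Color ε) (one : 𝟙_ (Color ε) ⟶ X) (mul : X ⊗ X ⟶ X)
    (one_mul : ∀ a, ap mul (te X X (ap one (Color.one ε 1)) a) = a)
    (mul_one : ∀ a, ap mul (te X X a (ap one (Color.one ε 1))) = a)
    (mul_assoc : ∀ a, ∀ x ∈ X.obj.deg a, ∀ b, ∀ y ∈ X.obj.deg b, ∀ c, ∀ z ∈ X.obj.deg c,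
      ap mul (te X X (ap mul (te X X x y)) z) = ap mul (te X X x (ap mul (te X X y z)))) :
    MonObj X where
  one := one
  mul := mul
  one_mul := hom_ext' (te_one_left_ext fun _ x _ => by
    rw [ap_comp, ap_whiskerRight, ap_leftUnitor_hom, one_mul, X.obj.lact_one])
  mul_one := hom_ext' (te_one_right_ext fun _ x _ => by
    rw [ap_comp, ap_whiskerLeft, ap_rightUnitor_hom, mul_one, X.obj.ract_one])
  mul_assoc := hom_ext' (te_ext₃ fun a x hx b y hy c z hz => by
    simpa only [ap_comp, ap_whiskerLeft, ap_whiskerRight, ap_associator_hom] using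
      mul_assoc a x hx b y hy c z hz)

/-! ### The braided opposite of a monoid object. -/

/-- The object underlying the opposite of a monoid object. -/
def opp (X : Color ε) : Color ε := X

theorem ap_braiding_mul {a b : B} {x y : X.obj.carrier} (hx : x ∈ X.obj.deg a)
    (hy : y ∈ X.obj.deg b) :
    ap ((β_ X X).hom ≫ μ[X]) (te X X x y) = (ε.toFun a b : k) • mulₗ X y x := by
  rw [ap_comp, ap_braiding hx hy, map_smul]
  rfl

theorem toFun_one_left (ε : ColorFactor k d) (b : B) : ε.toFun 1 b = 1 := by
  have h := ε.map_mul_left 1 1 b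
  rwa [mul_one, left_eq_mul] at h

theorem toFun_one_right (ε : ColorFactor k d) (b : B) : ε.toFun b 1 = 1 := by
  rw [ε.antisymm, toFun_one_left, inv_one]

/-- The opposite monoid, with product `x · y = ε(|x|, |y|) y x`. -/
instance : MonObj (opp X) :=
  monObjOfMul X η[X] ((β_ X X).hom ≫ μ[X])
    (fun a => by
      have h1 : el X 1 ∈ X.obj.deg 1 := by simpa using el_mem (X := X) 1
      have : ap ((β_ X X).hom ≫ μ[X]) ∘ₗ te X X (el X 1) = LinearMap.id :=
        lin_ext fun b y hy => by
          rw [LinearMap.comp_apply, ap_braiding_mul h1 hy, mulₗ_el_one, toFun_one_left]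
          simp
      exact LinearMap.congr_fun this a)
    (fun a => by
      have h1 : el X 1 ∈ X.obj.deg 1 := by simpa using el_mem (X := X) 1
      have : ap ((β_ X X).hom ≫ μ[X]) ∘ₗ (te X X).flip (el X 1) = LinearMap.id :=
        lin_ext fun b y hy => by
          rw [LinearMap.comp_apply, LinearMap.flip_apply, ap_braiding_mul hy h1, el_one_mulₗ,
            toFun_one_right]
          simp
      exact LinearMap.congr_fun this a)
    (fun a x hx b y hy c z hz => by
      rw [ap_braiding_mul hx hy, ap_braiding_mul hy hz]
      simp only [map_smul, LinearMap.smul_apply]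
      -- Both bracketings give z y x, with scalars ε(x,y) ε(yx,z) and ε(y,z) ε(x,zy), equal by
      -- bimultiplicativity.
      rw [ap_braiding_mul (mulₗ_mem hy hx) hz, ap_braiding_mul hx (mulₗ_mem hz hy), mulₗ_assoc,
        smul_smul, smul_smul, ε.map_mul_left, ε.map_mul_right]
      congr 1
      push_cast
      ring)

theorem mulₗ_opp {a b : B} {x y : X.obj.carrier} (hx : x ∈ X.obj.deg a)
    (hy : y ∈ X.obj.deg b) : mulₗ (opp X) x y = (ε.toFun a b : k) • mulₗ X y x :=
  ap_braiding_mul hx hy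

end Mon

end Color

end GradedBimod

namespace DrinfeldDatum

open GradedBimod Color
open scoped MonObj ComonObj

variable {k V G : Type u} [Field k] [AddCommGroup V] [Module k V] [CommGroup G] {n : ℕ}
  (D : DrinfeldDatum k V G n) (hli : LinearIndependent k D.monomial) (hSV : D.StrongVanishing)
  (hgr : D.IsGraded)

/-! ### `H_{q,κ}` as a monoid object -/

/-- `H_{q,κ}` as an object of the category of color bimodules. -/
def obj : Color (D.colorFactor hli hSV) := ⟨D.bimod hgr, D.isColor_bimod hli hSV hgr⟩

/-- The identity map from `H_{q,κ}` to the space underlying the color bimodule. -/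
def toObj : D.H ≃ₗ[k] (D.obj hli hSV hgr).obj.carrier := LinearEquiv.refl k D.H

local notation "𝐇" => D.obj hli hSV hgr

local notation "ⓗ" => D.toObj hli hSV hgr

theorem lact_toObj (g : G) (a : D.H) : 𝐇.obj.lact g (ⓗ a) = ⓗ (D.γ g * a) := rfl

theorem ract_toObj (g : G) (a : D.H) : 𝐇.obj.ract g (ⓗ a) = ⓗ (a * D.γ g) := rfl

theorem toObj_mem {b : D.A ⧸ D.N} {a : D.H} (ha : a ∈ D.deg b) : ⓗ a ∈ 𝐇.obj.deg b := ha

theorem toObj_x_mem (i : Fin n) : ⓗ (D.x i) ∈ 𝐇.obj.deg (D.degV i) :=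
  D.toObj_mem hli hSV hgr (D.x_mem i)

theorem one_mem_deg : (1 : D.H) ∈ D.deg 1 := by
  simpa using D.γ_mem 1

theorem toObj_one_mem : ⓗ 1 ∈ 𝐇.obj.deg 1 := D.toObj_mem hli hSV hgr D.one_mem_deg

/-- The unit `k[G] ⟶ H_{q,κ}`. -/
def oneHom : 𝟙_ (Color (D.colorFactor hli hSV)) ⟶ 𝐇 :=
  ObjectProperty.homMk
    { toLin := unitLift (d := D.groupDegree) fun g => ⓗ (D.γ g)
      map_lact := fun g => LinearMap.congr_fun
        (f := unitLift (d := D.groupDegree) (fun g => ⓗ (D.γ g)) ∘ₗ (unit k D.groupDegree).lact g)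
        (g := 𝐇.obj.lact g ∘ₗ unitLift (d := D.groupDegree) fun g => ⓗ (D.γ g))
        (unit_ext fun h => by
          simp only [LinearMap.comp_apply, unit_lact, unitLift_grp, lact_toObj, map_mul])
      map_ract := fun g => LinearMap.congr_fun
        (f := unitLift (d := D.groupDegree) (fun g => ⓗ (D.γ g)) ∘ₗ (unit k D.groupDegree).ract g)
        (g := 𝐇.obj.ract g ∘ₗ unitLift (d := D.groupDegree) fun g => ⓗ (D.γ g))
        (unit_ext fun h => by
          simp only [LinearMap.comp_apply, unit_ract, unitLift_grp, ract_toObj, map_mul])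
      map_deg := fun b => unit_deg_le _ b _ fun g hg => by
        rw [unitLift_grp, ← hg]
        exact D.γ_mem g }

theorem ap_oneHom (g : G) : ap (D.oneHom hli hSV hgr) (Color.one _ g) = ⓗ (D.γ g) :=
  unitLift_grp (d := D.groupDegree) (fun g => ⓗ (D.γ g)) g

/-- The bilinear multiplication of `H_{q,κ}`. -/
def mulLin : (D.bimod hgr).carrier →ₗ[k] (D.bimod hgr).carrier →ₗ[k] (D.bimod hgr).carrier :=
  LinearMap.mul k D.H

theorem mulLin_bal (g : G) (a b : (D.bimod hgr).carrier) :
    D.mulLin hgr ((D.bimod hgr).ract g a) b = D.mulLin hgr a ((D.bimod hgr).lact g b) :=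
  mul_assoc (show D.H from a) (D.γ g) b

/-- The multiplication of `H_{q,κ}` as a morphism of graded bimodules. -/
def mulBimodHom : tensor (D.bimod hgr) (D.bimod hgr) ⟶ D.bimod hgr where
  toLin := GradedBimod.lift (D.mulLin hgr) (D.mulLin_bal hgr)
  map_lact g := LinearMap.congr_fun
    (f := GradedBimod.lift (D.mulLin hgr) (D.mulLin_bal hgr) ∘ₗ
      (tensor (D.bimod hgr) (D.bimod hgr)).lact g)
    (g := (D.bimod hgr).lact g ∘ₗ GradedBimod.lift (D.mulLin hgr) (D.mulLin_bal hgr))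
    (tensor_ext fun a b => by
      simp only [LinearMap.comp_apply, tensor_lact, lift_tmul]
      exact mul_assoc (D.γ g) (show D.H from a) b)
  map_ract g := LinearMap.congr_fun
    (f := GradedBimod.lift (D.mulLin hgr) (D.mulLin_bal hgr) ∘ₗ
      (tensor (D.bimod hgr) (D.bimod hgr)).ract g)
    (g := (D.bimod hgr).ract g ∘ₗ GradedBimod.lift (D.mulLin hgr) (D.mulLin_bal hgr))
    (tensor_ext fun a b => by
      simp only [LinearMap.comp_apply, tensor_ract, lift_tmul]
      exact (mul_assoc (show D.H from a) b (D.γ g)).symm)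
  map_deg c := tensor_deg_le _ c _ fun a b m m' hm hm' hc => by
    rw [lift_tmul, ← hc]
    exact D.mul_mem hm hm'

/-- The multiplication of `H_{q,κ}`. -/
def mulHom : 𝐇 ⊗ 𝐇 ⟶ 𝐇 := ObjectProperty.homMk (D.mulBimodHom hgr)

theorem ap_mulHom (a b : D.H) :
    ap (D.mulHom hli hSV hgr) (te 𝐇 𝐇 (ⓗ a) (ⓗ b)) = ⓗ (a * b) :=
  lift_tmul (D.mulLin hgr) (D.mulLin_bal hgr) a b

instance : MonObj 𝐇 :=
  monObjOfMul 𝐇 (D.oneHom hli hSV hgr) (D.mulHom hli hSV hgr)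
    (fun a => by
      rw [ap_oneHom, map_one]
      exact (D.ap_mulHom hli hSV hgr 1 a).trans (one_mul (show D.H from a)))
    (fun a => by
      rw [ap_oneHom, map_one]
      exact (D.ap_mulHom hli hSV hgr a 1).trans (mul_one (show D.H from a)))
    (fun _ x _ _ y _ _ z _ => by
      obtain ⟨x, rfl⟩ := (ⓗ).surjective x
      obtain ⟨y, rfl⟩ := (ⓗ).surjective y
      obtain ⟨z, rfl⟩ := (ⓗ).surjective z
      simp only [ap_mulHom, mul_assoc])

theorem el_obj (g : G) : el 𝐇 g = ⓗ (D.γ g) := D.ap_oneHom hli hSV hgr g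

theorem el_obj_one : el 𝐇 1 = ⓗ 1 := by rw [el_obj, map_one]

theorem mulₗ_obj (a b : D.H) : mulₗ 𝐇 (ⓗ a) (ⓗ b) = ⓗ (a * b) := D.ap_mulHom hli hSV hgr a b

/-! ### Morphisms out of `H_{q,κ}` -/

variable {D hli hSV hgr} in
/-- Bimodule morphisms out of `H_{q,κ}` are determined by their values on words. -/
theorem obj_hom_ext {Y : Color (D.colorFactor hli hSV)} {f f' : 𝐇 ⟶ Y}
    (hspan : Submodule.span k (Set.range D.monomial) = ⊤)
    (h : ∀ w : List (Fin n), ap f (ⓗ (w.map D.x).prod) = ap f' (ⓗ (w.map D.x).prod)) : f = f' := by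
  have : ap f ∘ₗ (ⓗ).toLinearMap = ap f' ∘ₗ (ⓗ).toLinearMap := by
    refine LinearMap.ext_on (D.span_words hspan) ?_
    rintro _ ⟨w, g, rfl⟩
    -- The trailing group element is a right action, which both morphisms respect; only the word
    -- itself has to be compared.
    simp only [LinearMap.comp_apply, LinearEquiv.coe_coe, ← ract_toObj, ap_ract, h]
  exact hom_ext' (LinearMap.ext fun a => LinearMap.congr_fun this a)

variable {D hli hSV hgr} in
/-- Monoid morphisms out of `H_{q,κ}` are determined by their values on the generators. -/
theorem obj_monHom_ext {Y : Color (D.colorFactor hli hSV)} [MonObj Y] {f f' : 𝐇 ⟶ Y} [IsMonHom f]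
    [IsMonHom f'] (hspan : Submodule.span k (Set.range D.monomial) = ⊤)
    (h : ∀ i, ap f (ⓗ (D.x i)) = ap f' (ⓗ (D.x i))) : f = f' := by
  refine obj_hom_ext hspan fun w => ?_
  induction w with
  | nil => rw [List.map_nil, List.prod_nil, ← el_obj_one, ap_el, ap_el]
  | cons i w ih => rw [List.map_cons, List.prod_cons, ← mulₗ_obj, ap_mulₗ, ap_mulₗ, h, ih]

section homOfGen

variable {Y : Color (D.colorFactor hli hSV)} [MonObj Y] (y : Fin n → Elts Y)
  (hy : ∀ i, y i ∈ eltsDeg Y (D.degV i))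
  (hrel : ∀ i j, y i * y j - (D.q i j : k) • (y j * y i) =
    D.mapVG y (elHom Y) (D.κ (D.v i) (D.v j)))

/-- The algebra morphism underlying `homOfGen`. -/
def algHomOfGen : D.H →ₐ[k] Elts Y :=
  D.liftH y (elHom Y) (fun g i => by
    rw [elHom_mul_of_mem (hy i), ← coe_degG, colorFactor_mk, bichar_degG_degV]) hrel

theorem algHomOfGen_x (i : Fin n) : D.algHomOfGen hli hSV y hy hrel (D.x i) = y i :=
  D.liftH_x y _ _ hrel i

theorem algHomOfGen_γ (g : G) : D.algHomOfGen hli hSV y hy hrel (D.γ g) = elHom Y g :=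
  D.liftH_γ y _ _ hrel g

/-- Degrees are multiplicative in Y, so it suffices that each `y i` has the degree of v_i. -/
theorem algHomOfGen_mem (b : D.A ⧸ D.N) (a : D.H) (ha : a ∈ D.deg b) :
    D.algHomOfGen hli hSV y hy hrel a ∈ eltsDeg Y b := by
  have hw : ∀ w : List (Fin n), D.algHomOfGen hli hSV y hy hrel (w.map D.x).prod ∈
      eltsDeg Y ((w.map D.degV).prod : D.A) := by
    intro w
    induction w with
    | nil =>
      rw [List.map_nil, List.map_nil, List.prod_nil, List.prod_nil, map_one]
      exact elts_one_mem
    | cons i w ih =>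
      rw [List.map_cons, List.map_cons, List.prod_cons, List.prod_cons, map_mul, algHomOfGen_x]
      exact elts_mul_mem (hy i) ih
  have : D.deg b ≤ (eltsDeg Y b).comap (D.algHomOfGen hli hSV y hy hrel).toLinearMap := by
    rw [deg, Submodule.span_le]
    rintro _ ⟨w, g, rfl, rfl⟩
    rw [SetLike.mem_coe, Submodule.mem_comap, AlgHom.toLinearMap_apply, map_mul, algHomOfGen_γ]
    exact elts_mul_mem (hw w) (elHom_mem g)
  exact this ha

/-- The morphism of graded bimodules underlying `homOfGen`. -/
def bimodHomOfGen : D.bimod hgr ⟶ Y.obj where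
  toLin := (D.algHomOfGen hli hSV y hy hrel).toLinearMap
  map_lact g a := by
    have h : D.algHomOfGen hli hSV y hy hrel (D.γ g * (show D.H from a)) =
        elHom Y g * D.algHomOfGen hli hSV y hy hrel a := by
      rw [map_mul, algHomOfGen_γ]
    exact h.trans (el_mulₗ (X := Y) g (D.algHomOfGen hli hSV y hy hrel a))
  map_ract g a := by
    have h : D.algHomOfGen hli hSV y hy hrel ((show D.H from a) * D.γ g) =
        D.algHomOfGen hli hSV y hy hrel a * elHom Y g := by
      rw [map_mul, algHomOfGen_γ]
    exact h.trans (mulₗ_el (X := Y) g (D.algHomOfGen hli hSV y hy hrel a))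
  map_deg := D.algHomOfGen_mem hli hSV y hy hrel

/-- The morphism `H_{q,κ} ⟶ Y` with `x i ↦ y i`. -/
def homOfGen : 𝐇 ⟶ Y := ObjectProperty.homMk (D.bimodHomOfGen hli hSV hgr y hy hrel)

theorem ap_homOfGen_x (i : Fin n) :
    ap (D.homOfGen hli hSV hgr y hy hrel) (ⓗ (D.x i)) = y i :=
  D.algHomOfGen_x hli hSV y hy hrel i

instance isMonHom_homOfGen : IsMonHom (D.homOfGen hli hSV hgr y hy hrel) :=
  isMonHom_of_ap _ (by
      rw [el_obj_one]
      exact map_one (D.algHomOfGen hli hSV y hy hrel))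
    (map_mul (D.algHomOfGen hli hSV y hy hrel))

end homOfGen

end DrinfeldDatum

namespace DrinfeldDatum

open GradedBimod Color
open scoped MonObj ComonObj

variable {k V G : Type u} [Field k] [AddCommGroup V] [Module k V] [CommGroup G] {n : ℕ}
  (D : DrinfeldDatum k V G n) (hli : LinearIndependent k D.monomial) (hSV : D.StrongVanishing)
  (hgr : D.IsGraded)

local notation "𝐇" => D.obj hli hSV hgr

local notation "ⓗ" => D.toObj hli hSV hgr

/-! ### The comultiplication, the counit and the antipode -/

/-- The element `x i ⊗ 1 + 1 ⊗ x i`. -/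
def comulGen (i : Fin n) : Elts (𝐇 ⊗ 𝐇) :=
  te 𝐇 𝐇 (ⓗ (D.x i)) (ⓗ 1) + te 𝐇 𝐇 (ⓗ 1) (ⓗ (D.x i))

theorem comulGen_mem (i : Fin n) : D.comulGen hli hSV hgr i ∈ eltsDeg (𝐇 ⊗ 𝐇) (D.degV i) :=
  Submodule.add_mem ((𝐇 ⊗ 𝐇).obj.deg _)
    (te_mem (D.toObj_x_mem hli hSV hgr i) (D.toObj_one_mem hli hSV hgr) (mul_one _))
    (te_mem (D.toObj_one_mem hli hSV hgr) (D.toObj_x_mem hli hSV hgr i) (one_mul _))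

/-- The factor q_ij is ε(|v_i|, |v_j|), produced when 1 ⊗ x_i is moved past x_j ⊗ 1. In the other
three products a unit is braided, at no cost. -/
theorem comulGen_mul (i j : Fin n) :
    D.comulGen hli hSV hgr i * D.comulGen hli hSV hgr j =
      (te 𝐇 𝐇 (ⓗ (D.x i * D.x j)) (ⓗ 1) + te 𝐇 𝐇 (ⓗ (D.x i)) (ⓗ (D.x j)) +
        ((D.q i j : k) • te 𝐇 𝐇 (ⓗ (D.x j)) (ⓗ (D.x i)) +
          te 𝐇 𝐇 (ⓗ 1) (ⓗ (D.x i * D.x j))) : (𝐇 ⊗ 𝐇).obj.carrier) := by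
  change mulₗ (𝐇 ⊗ 𝐇) (te 𝐇 𝐇 (ⓗ (D.x i)) (ⓗ 1) + te 𝐇 𝐇 (ⓗ 1) (ⓗ (D.x i)))
    (te 𝐇 𝐇 (ⓗ (D.x j)) (ⓗ 1) + te 𝐇 𝐇 (ⓗ 1) (ⓗ (D.x j))) = _
  have hx := D.toObj_x_mem hli hSV hgr
  have h1 := D.toObj_one_mem hli hSV hgr
  rw [map_add, map_add, LinearMap.add_apply, LinearMap.add_apply, te_mulₗ_te h1 (hx j),
    te_mulₗ_te (hx i) (hx j), te_mulₗ_te h1 h1, te_mulₗ_te (hx i) h1]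
  simp only [mulₗ_obj, mul_one, one_mul, toFun_one_left, toFun_one_right, Units.val_one, one_smul,
    colorFactor_mk, bichar_degV_degV]
  abel

/-- Holds because the tensor product is over k[G]: (x_r ⊗ 1) g = x_r ⊗ g = x_r g ⊗ 1, while (1 ⊗
x_r) g = 1 ⊗ x_r g. -/
theorem mapVG_comulGen (t : V ⊗[k] MonoidAlgebra k G) :
    D.mapVG (D.comulGen hli hSV hgr) (elHom (𝐇 ⊗ 𝐇)) t =
      (te 𝐇 𝐇 (ⓗ (D.mapVG D.x D.γ t)) (ⓗ 1) + te 𝐇 𝐇 (ⓗ 1) (ⓗ (D.mapVG D.x D.γ t)) :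
        (𝐇 ⊗ 𝐇).obj.carrier) := by
  let f : V ⊗[k] MonoidAlgebra k G →ₗ[k] Elts (𝐇 ⊗ 𝐇) :=
    ((te 𝐇 𝐇).flip (ⓗ 1) + te 𝐇 𝐇 (ⓗ 1)) ∘ₗ (ⓗ).toLinearMap ∘ₗ D.mapVG D.x D.γ
  have : D.mapVG (D.comulGen hli hSV hgr) (elHom (𝐇 ⊗ 𝐇)) = f := D.basisVG.ext fun ⟨r, g⟩ => by
    have e : f (D.basisVG (r, g)) =
        (te 𝐇 𝐇 (ⓗ (D.mapVG D.x D.γ (D.basisVG (r, g)))) (ⓗ 1) +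
          te 𝐇 𝐇 (ⓗ 1) (ⓗ (D.mapVG D.x D.γ (D.basisVG (r, g)))) : (𝐇 ⊗ 𝐇).obj.carrier) := rfl
    rw [e, mapVG_basisVG, mapVG_basisVG]
    refine (mulₗ_el (X := 𝐇 ⊗ 𝐇) g (D.comulGen hli hSV hgr r)).trans ?_
    refine (map_add ((𝐇 ⊗ 𝐇).obj.ract g) _ _).trans ?_
    rw [ract_te, ract_te, ← ract_toObj, te_ract, lact_toObj, ract_toObj, ract_toObj, one_mul,
      mul_one]
  exact LinearMap.congr_fun this t

/-- In the q-commutator the terms x_j ⊗ x_i cancel directly and the terms x_i ⊗ x_j cancel through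
q_ij q_ji = 1. What remains is the defining relation in each tensor factor. -/
theorem comulGen_rel (i j : Fin n) :
    D.comulGen hli hSV hgr i * D.comulGen hli hSV hgr j -
      (D.q i j : k) • (D.comulGen hli hSV hgr j * D.comulGen hli hSV hgr i) =
        D.mapVG (D.comulGen hli hSV hgr) (elHom (𝐇 ⊗ 𝐇)) (D.κ (D.v i) (D.v j)) := by
  rw [comulGen_mul, comulGen_mul, mapVG_comulGen, ← x_mul_x_sub]
  have hq : (D.q i j : k) * (D.q j i : k) = 1 := by rw [D.q_symm i j]; simp
  have h : ∀ (a b c d e f : (𝐇 ⊗ 𝐇).obj.carrier),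
      a + c + ((D.q i j : k) • d + e) - (D.q i j : k) • (b + d + ((D.q j i : k) • c + f)) =
        a - (D.q i j : k) • b + (e - (D.q i j : k) • f) := by
    intro a b c d e f
    simp only [smul_add, smul_smul, hq, one_smul]
    abel
  simp only [map_sub, map_smul, LinearMap.sub_apply, LinearMap.smul_apply]
  exact h _ _ _ _ _ _

/-- The comultiplication of `H_{q,κ}`. -/
def comulHom : 𝐇 ⟶ 𝐇 ⊗ 𝐇 :=
  D.homOfGen hli hSV hgr (D.comulGen hli hSV hgr) (D.comulGen_mem hli hSV hgr)
    (D.comulGen_rel hli hSV hgr)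

instance : IsMonHom (D.comulHom hli hSV hgr) :=
  D.isMonHom_homOfGen hli hSV hgr _ _ _

theorem ap_comulHom_x (i : Fin n) : ap (D.comulHom hli hSV hgr) (ⓗ (D.x i)) =
    te 𝐇 𝐇 (ⓗ (D.x i)) (ⓗ 1) + te 𝐇 𝐇 (ⓗ 1) (ⓗ (D.x i)) :=
  D.ap_homOfGen_x hli hSV hgr _ _ _ i

theorem ap_toObj_one {Y : Color (D.colorFactor hli hSV)} [MonObj Y] (f : 𝐇 ⟶ Y) [IsMonHom f] :
    ap f (ⓗ 1) = el Y 1 := by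
  rw [← el_obj_one, ap_el]

theorem ap_comulHom_one : ap (D.comulHom hli hSV hgr) (ⓗ 1) = te 𝐇 𝐇 (ⓗ 1) (ⓗ 1) := by
  rw [ap_toObj_one, el_tensor, el_obj_one]

/-- The counit of `H_{q,κ}`. -/
def counitHom : 𝐇 ⟶ 𝟙_ (Color (D.colorFactor hli hSV)) :=
  D.homOfGen hli hSV hgr (fun _ => 0) (fun _ => Submodule.zero_mem _) (fun i j => by
    rw [mul_zero, smul_zero, sub_zero]
    -- Every term of κ contains exactly one vector v_r, so κ goes to 0 together with the generators.
    have : D.mapVG (fun _ => (0 : Elts (𝟙_ (Color (D.colorFactor hli hSV))))) (elHom _) = 0 :=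
      D.basisVG.ext fun ⟨r, g⟩ => by rw [mapVG_basisVG, zero_mul, LinearMap.zero_apply]
    rw [this, LinearMap.zero_apply])

instance : IsMonHom (D.counitHom hli hSV hgr) :=
  D.isMonHom_homOfGen hli hSV hgr _ _ _

theorem ap_counitHom_x (i : Fin n) : ap (D.counitHom hli hSV hgr) (ⓗ (D.x i)) = 0 :=
  D.ap_homOfGen_x hli hSV hgr _ _ _ i

theorem ap_counitHom_one : ap (D.counitHom hli hSV hgr) (ⓗ 1) = Color.one _ 1 := by
  rw [ap_toObj_one, el_unit]

/-! ### The antipode, as a morphism to the braided opposite. -/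

/-- The element `-x i` of the opposite monoid. -/
def antipodeGen (i : Fin n) : Elts (opp 𝐇) := -(ⓗ (D.x i))

theorem neg_toObj_x_mem (i : Fin n) : -(ⓗ (D.x i)) ∈ (𝐇).obj.deg (D.degV i) :=
  Submodule.neg_mem _ (D.toObj_x_mem hli hSV hgr i)

theorem antipodeGen_mul (i j : Fin n) :
    D.antipodeGen hli hSV hgr i * D.antipodeGen hli hSV hgr j =
      ((D.q i j : k) • ⓗ (D.x j * D.x i) : (𝐇).obj.carrier) := by
  refine (mulₗ_opp (X := 𝐇) (D.neg_toObj_x_mem hli hSV hgr i)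
    (D.neg_toObj_x_mem hli hSV hgr j)).trans ?_
  rw [colorFactor_mk, bichar_degV_degV, ← map_neg, ← map_neg, mulₗ_obj, neg_mul_neg]

/-- The opposite monoid has the same underlying bimodule, so multiplying by g on the right in it is
still the right action of H; the reversal of factors and the scalar ε compensate each other. -/
theorem mapVG_antipodeGen (t : V ⊗[k] MonoidAlgebra k G) :
    D.mapVG (D.antipodeGen hli hSV hgr) (elHom (opp 𝐇)) t =
      (-ⓗ (D.mapVG D.x D.γ t) : (𝐇).obj.carrier) := by
  let f : V ⊗[k] MonoidAlgebra k G →ₗ[k] Elts (opp 𝐇) := -((ⓗ).toLinearMap ∘ₗ D.mapVG D.x D.γ)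
  have : D.mapVG (D.antipodeGen hli hSV hgr) (elHom (opp 𝐇)) = f := D.basisVG.ext fun ⟨r, g⟩ => by
    have e : f (D.basisVG (r, g)) =
        (-ⓗ (D.mapVG D.x D.γ (D.basisVG (r, g))) : (𝐇).obj.carrier) := rfl
    rw [e, mapVG_basisVG, mapVG_basisVG]
    refine (mulₗ_el (X := opp 𝐇) g (D.antipodeGen hli hSV hgr r)).trans ?_
    exact (map_neg ((𝐇).obj.ract g) _).trans (by rw [ract_toObj])
  exact LinearMap.congr_fun this t

/-- The two signs cancel in the products, and braided reversal turns the q-commutator into q_ij x_j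
x_i - q_ij q_ji x_i x_j. This is minus the original q-commutator, matching the single sign that κ
receives. -/
theorem antipodeGen_rel (i j : Fin n) :
    D.antipodeGen hli hSV hgr i * D.antipodeGen hli hSV hgr j -
      (D.q i j : k) • (D.antipodeGen hli hSV hgr j * D.antipodeGen hli hSV hgr i) =
        D.mapVG (D.antipodeGen hli hSV hgr) (elHom (opp 𝐇)) (D.κ (D.v i) (D.v j)) := by
  rw [antipodeGen_mul, antipodeGen_mul, mapVG_antipodeGen, ← x_mul_x_sub]
  have hq : (D.q i j : k) * (D.q j i : k) = 1 := by rw [D.q_symm i j]; simp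
  have h : ∀ (a b : (𝐇).obj.carrier),
      (D.q i j : k) • b - (D.q i j : k) • ((D.q j i : k) • a) = -(a - (D.q i j : k) • b) := by
    intro a b
    rw [smul_smul, hq, one_smul, neg_sub]
  simp only [map_sub, map_smul]
  exact h _ _

/-- The antipode of `H_{q,κ}` as a morphism to the opposite monoid. -/
def antipodeOppHom : 𝐇 ⟶ opp 𝐇 :=
  D.homOfGen hli hSV hgr (D.antipodeGen hli hSV hgr) (D.neg_toObj_x_mem hli hSV hgr)
    (D.antipodeGen_rel hli hSV hgr)

instance : IsMonHom (D.antipodeOppHom hli hSV hgr) :=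
  D.isMonHom_homOfGen hli hSV hgr (Y := opp 𝐇) _ _ _

/-- The antipode of `H_{q,κ}`. -/
def antipodeHom : 𝐇 ⟶ 𝐇 := D.antipodeOppHom hli hSV hgr

theorem ap_antipodeHom_x (i : Fin n) :
    ap (D.antipodeHom hli hSV hgr) (ⓗ (D.x i)) = -(ⓗ (D.x i)) :=
  D.ap_homOfGen_x hli hSV hgr (Y := opp 𝐇) _ _ _ i

theorem ap_antipodeHom_one : ap (D.antipodeHom hli hSV hgr) (ⓗ 1) = ⓗ 1 :=
  (D.ap_toObj_one hli hSV hgr (D.antipodeOppHom hli hSV hgr)).trans (D.el_obj_one hli hSV hgr)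

/-- Braided antimultiplicativity of S: being a monoid morphism into the opposite, read in H itself.
-/
theorem ap_antipodeHom_mulₗ {a b : D.A ⧸ D.N} {y z : (𝐇).obj.carrier} (hy : y ∈ (𝐇).obj.deg a)
    (hz : z ∈ (𝐇).obj.deg b) : ap (D.antipodeHom hli hSV hgr) (mulₗ 𝐇 y z) =
      ((D.colorFactor hli hSV).toFun a b : k) •
        mulₗ 𝐇 (ap (D.antipodeHom hli hSV hgr) z) (ap (D.antipodeHom hli hSV hgr) y) :=
  (ap_mulₗ (D.antipodeOppHom hli hSV hgr) y z).trans
    (mulₗ_opp (ap_mem (D.antipodeHom hli hSV hgr) hy) (ap_mem (D.antipodeHom hli hSV hgr) hz))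

/-! ### The Hopf axioms -/

/-- `H_{q,κ}` as a comonoid object. -/
@[reducible]
def comonObj (hspan : Submodule.span k (Set.range D.monomial) = ⊤) : ComonObj 𝐇 where
  counit := D.counitHom hli hSV hgr
  comul := D.comulHom hli hSV hgr
  -- In each of the three axioms both sides are monoid morphisms, so comparing them on the x_i is
  -- enough.
  counit_comul := obj_monHom_ext hspan fun i => by
    simp only [ap_comp, ap_comulHom_x, map_add, ap_whiskerRight, ap_leftUnitor_inv, ap_counitHom_x,
      ap_counitHom_one, map_zero, LinearMap.zero_apply, zero_add]
  comul_counit := obj_monHom_ext hspan fun i => by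
    simp only [ap_comp, ap_comulHom_x, map_add, ap_whiskerLeft, ap_rightUnitor_inv, ap_counitHom_x,
      ap_counitHom_one, map_zero, add_zero]
  comul_assoc := obj_monHom_ext hspan fun i => by
    simp only [ap_comp, ap_comulHom_x, map_add, ap_whiskerLeft, ap_whiskerRight, ap_associator_hom,
      ap_comulHom_one, LinearMap.add_apply]
    abel

/-- For t = y ⊗ z the product Δ(x) t is xy ⊗ z + ε(x,y) y ⊗ xz. It is sent to S(xy) z + ε(x,y) S(y)
x z, and S(xy) = ε(x,y) S(y) S(x) = -ε(x,y) S(y) x. -/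
theorem antipode_left_mul_x (i : Fin n) (t : (𝐇 ⊗ 𝐇).obj.carrier) :
    ap (D.antipodeHom hli hSV hgr ▷ 𝐇 ≫ μ[𝐇])
      (mulₗ (𝐇 ⊗ 𝐇) (ap (D.comulHom hli hSV hgr) (ⓗ (D.x i))) t) = 0 := by
  have : ap (D.antipodeHom hli hSV hgr ▷ 𝐇 ≫ μ[𝐇]) ∘ₗ
      mulₗ (𝐇 ⊗ 𝐇) (ap (D.comulHom hli hSV hgr) (ⓗ (D.x i))) = 0 := te_ext fun a y hy b z hz => by
    have hx := D.toObj_x_mem hli hSV hgr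
    have h1 := D.toObj_one_mem hli hSV hgr
    rw [LinearMap.comp_apply, ap_comulHom_x, map_add, LinearMap.add_apply, te_mulₗ_te h1 hy,
      te_mulₗ_te (hx i) hy, ← el_obj_one, el_one_mulₗ, el_one_mulₗ, map_add, map_smul, map_smul,
      ap_comp, ap_comp, ap_whiskerRight, ap_whiskerRight, ap_antipodeHom_mulₗ _ _ _ _ (hx i) hy,
      ap_antipodeHom_x]
    simp only [map_neg, map_smul, LinearMap.neg_apply, LinearMap.smul_apply, ← mulₗ_apply,
      mulₗ_assoc, toFun_one_left, Units.val_one, one_smul, smul_neg, neg_add_cancel,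
      LinearMap.zero_apply]
  exact LinearMap.congr_fun this t

/-- Mirror image: (y ⊗ z) Δ(x) is sent to ε(z,x) y x S(z) + y S(zx), and S(zx) = -ε(z,x) x S(z). -/
theorem antipode_right_mul_x (i : Fin n) (t : (𝐇 ⊗ 𝐇).obj.carrier) :
    ap (𝐇 ◁ D.antipodeHom hli hSV hgr ≫ μ[𝐇])
      (mulₗ (𝐇 ⊗ 𝐇) t (ap (D.comulHom hli hSV hgr) (ⓗ (D.x i)))) = 0 := by
  have : ap (𝐇 ◁ D.antipodeHom hli hSV hgr ≫ μ[𝐇]) ∘ₗ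
      (mulₗ (𝐇 ⊗ 𝐇)).flip (ap (D.comulHom hli hSV hgr) (ⓗ (D.x i))) = 0 :=
    te_ext fun a y hy b z hz => by
      have hx := D.toObj_x_mem hli hSV hgr
      have h1 := D.toObj_one_mem hli hSV hgr
      rw [LinearMap.comp_apply, LinearMap.flip_apply, ap_comulHom_x, map_add, te_mulₗ_te hz (hx i),
        te_mulₗ_te hz h1, ← el_obj_one, mulₗ_el_one, mulₗ_el_one, map_add, map_smul, map_smul,
        ap_comp, ap_comp, ap_whiskerLeft, ap_whiskerLeft, ap_antipodeHom_mulₗ _ _ _ _ hz (hx i),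
        ap_antipodeHom_x]
      simp only [map_neg, map_smul, LinearMap.neg_apply, ← mulₗ_apply, mulₗ_assoc, toFun_one_right,
        Units.val_one, one_smul, smul_neg, add_neg_cancel, LinearMap.zero_apply]
  exact LinearMap.congr_fun this t

theorem ap_counitHom_one_comp : ap (D.counitHom hli hSV hgr ≫ η[𝐇]) (ⓗ 1) = ⓗ 1 := by
  rw [ap_comp, ap_counitHom_one]
  exact D.el_obj_one hli hSV hgr

theorem comul_antipode_one_left :
    ap (D.comulHom hli hSV hgr ≫ D.antipodeHom hli hSV hgr ▷ 𝐇 ≫ μ[𝐇]) (ⓗ 1) = ⓗ 1 := by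
  rw [ap_comp, ap_comp, ap_comulHom_one, ap_whiskerRight, ap_antipodeHom_one, ← mulₗ_apply,
    mulₗ_obj, mul_one]

theorem comul_antipode_one_right :
    ap (D.comulHom hli hSV hgr ≫ 𝐇 ◁ D.antipodeHom hli hSV hgr ≫ μ[𝐇]) (ⓗ 1) = ⓗ 1 := by
  rw [ap_comp, ap_comp, ap_comulHom_one, ap_whiskerLeft, ap_antipodeHom_one, ← mulₗ_apply,
    mulₗ_obj, mul_one]

/-- The convolution is not a monoid morphism, so generators do not suffice and words are needed. On
a nonempty word the first letter makes both sides vanish; on the empty word both give 1. -/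
theorem comul_antipode_left (hspan : Submodule.span k (Set.range D.monomial) = ⊤) :
    D.comulHom hli hSV hgr ≫ D.antipodeHom hli hSV hgr ▷ 𝐇 ≫ μ[𝐇] =
      D.counitHom hli hSV hgr ≫ η[𝐇] :=
  obj_hom_ext hspan fun w => by
    cases w with
    | nil => rw [List.map_nil, List.prod_nil, comul_antipode_one_left, ap_counitHom_one_comp]
    | cons i w =>
      rw [List.map_cons, List.prod_cons, ← mulₗ_obj, ap_comp, ap_mulₗ, antipode_left_mul_x,
        ap_comp, ap_mulₗ, ap_counitHom_x, map_zero, LinearMap.zero_apply, map_zero]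

theorem comul_antipode_right (hspan : Submodule.span k (Set.range D.monomial) = ⊤) :
    D.comulHom hli hSV hgr ≫ 𝐇 ◁ D.antipodeHom hli hSV hgr ≫ μ[𝐇] =
      D.counitHom hli hSV hgr ≫ η[𝐇] :=
  obj_hom_ext hspan fun w => by
    -- Here the last letter is split off, since `antipode_right_mul_x` absorbs Δ(x_i) on the right.
    rcases w.eq_nil_or_concat' with rfl | ⟨w, i, rfl⟩
    · rw [List.map_nil, List.prod_nil, comul_antipode_one_right, ap_counitHom_one_comp]
    · rw [List.map_append, List.prod_append, List.map_singleton, List.prod_singleton, ← mulₗ_obj,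
        ap_comp, ap_mulₗ, antipode_right_mul_x, ap_comp, ap_mulₗ, ap_counitHom_x, map_zero,
        map_zero]

/-- `H_{q,κ}` as a bimonoid object. -/
@[reducible]
def bimonObj (hspan : Submodule.span k (Set.range D.monomial) = ⊤) : BimonObj 𝐇 :=
  letI := D.comonObj hli hSV hgr hspan
  { (inferInstance : MonObj 𝐇), (inferInstance : ComonObj 𝐇) with
    -- The four compatibilities of a bimonoid say exactly that Δ and the counit are monoid
    -- morphisms, which they are by construction.
    mul_comul := (IsMonHom.mul_hom (D.comulHom hli hSV hgr)).trans (by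
      rw [MonObj.tensorObj.mul_def]
      rfl)
    one_comul := IsMonHom.one_hom (D.comulHom hli hSV hgr)
    mul_counit := (IsMonHom.mul_hom (D.counitHom hli hSV hgr)).trans (by
      rw [Comon.tensorObj_counit]
      rfl)
    one_counit := IsMonHom.one_hom (D.counitHom hli hSV hgr) }

/-- `H_{q,κ}` as a Hopf monoid object. -/
@[reducible]
def hopfObj (hspan : Submodule.span k (Set.range D.monomial) = ⊤) : HopfObj 𝐇 :=
  { D.bimonObj hli hSV hgr hspan with
    antipode := D.antipodeHom hli hSV hgr
    antipode_left := D.comul_antipode_left hli hSV hgr hspan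
    antipode_right := D.comul_antipode_right hli hSV hgr hspan }

end DrinfeldDatum

end

/-! ### The main theorem. -/

theorem corollary6p3 {k V G : Type u} [Field k] [CharZero k] [AddCommGroup V] [Module k V]
    [CommGroup G] [Finite G] {n : ℕ} (D : DrinfeldDatum k V G n)
    (hPBW : D.IsQuantumDrinfeldOrbifoldAlgebra) (hSV : D.StrongVanishing) :
    ∃ ε : ColorFactor k D.groupDegree,
      (∀ i j g h, ε.toFun (D.degVG i g) (D.degVG j h) = D.q i j * D.χ j g * (D.χ i h)⁻¹) ∧
      ∃ (hgr : D.IsGraded) (hcol : GradedBimod.IsColor ε (D.bimod hgr))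
        (hopf : HopfObj (⟨D.bimod hgr, hcol⟩ : GradedBimod.Color ε)),
        (∀ a b : D.H, hopf.mul.hom.toLin
          (GradedBimod.tmul (D.bimod hgr) (D.bimod hgr) (D.toBimod hgr a) (D.toBimod hgr b)) =
            D.toBimod hgr (a * b)) ∧
        (∀ g, hopf.one.hom.toLin (GradedBimod.grp D.groupDegree g) = D.toBimod hgr (D.γ g)) ∧
        (∀ i, hopf.comul.hom.toLin (D.toBimod hgr (D.x i)) =
          GradedBimod.tmul (D.bimod hgr) (D.bimod hgr) (D.toBimod hgr (D.x i)) (D.toBimod hgr 1) +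
            GradedBimod.tmul (D.bimod hgr) (D.bimod hgr) (D.toBimod hgr 1) (D.toBimod hgr (D.x i))) ∧
        (∀ i, hopf.counit.hom.toLin (D.toBimod hgr (D.x i)) = 0) ∧
        (∀ i, hopf.antipode.hom.toLin (D.toBimod hgr (D.x i)) = -D.toBimod hgr (D.x i)) := by
  -- Spanning by PBW monomials gives the grading and the Hopf axioms; their independence lets the
  -- bicharacter descend to A/N.
  let hgr := D.isGraded hPBW.2
  exact ⟨D.colorFactor hPBW.1 hSV, D.colorFactor_degVG hPBW.1 hSV, hgr,
    D.isColor_bimod hPBW.1 hSV hgr, D.hopfObj hPBW.1 hSV hgr hPBW.2,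
    D.mulₗ_obj hPBW.1 hSV hgr, D.el_obj hPBW.1 hSV hgr, D.ap_comulHom_x hPBW.1 hSV hgr,
    D.ap_counitHom_x hPBW.1 hSV hgr, D.ap_antipodeHom_x hPBW.1 hSV hgr⟩
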